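/- Let $n\ge 0$ and $\omega=e^{i\pi/4}$. The Clifford+$T$ gates on $n$ qubits are the following operators on $(\mathbb{C}^2)^{\otimes n}$, written as $2^n\times 2^n$ matrices in the computational basis $\{0,1\}^n$: the scalar $\omega$ (times the identity); the gates $$H=\frac1{\sqrt2}\begin{pmatrix}1&1\\1&-1\end{pmatrix},\qquad S=\begin{pmatrix}1&0\\0&i\end{pmatrix},\qquad T=\begin{pmatrix}1&0\\0&e^{i\pi/4}\end{pmatrix}$$ applied to any one of the $n$ qubits; and the controlled-not gate applied to any ordered pair of distinct qubits. Let $\mathbb{Z}[\frac1{\sqrt2},i]$ be the subring of $\mathbb{C}$ generated by $\frac1{\sqrt2}$ and $i$. Let $U$ be a unitary $2^n\times 2^n$ matrix. Then the following are equivalent: (a) $U$ can be exactly represented by a quantum circuit over the Clifford+$T$ gate set on $n$ qubits with no ancillas, i.e. $U$ is the product of a finite (possibly empty) sequence of Clifford+$T$ gates on $n$ qubits. (Every gate has finite order, so these products form a group, the ancilla-free $n$-qubit Clifford+$T$ group.) (b) The entries of $U$ belong to the ring $\mathbb{Z}[\frac1{\sqrt2},i]$, and: - $\det U=1$, if $n\ge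 4$; - $\det U\in\{-1,1\}$, if $n=3$; - $\det U\in\{i,-1,-i,1\}$, if $n=2$; - $\det U\in\{\omega,i,\omega^3,-1,\omega^5,-i,\omega^7,1\}$, if $n\le 1$. -/

import Mathlib

noncomputable section

namespace CliffordT

/-- Computational basis states of `n` qubits, that is, bit strings of length `n`. There are `2 ^ n`
of them, so a `2 ^ n × 2 ^ n` matrix is a matrix with rows and columns indexed by `Basis n`. -/
abbrev Basis (n : ℕ) : Type := Fin n → Fin 2

/-- The primitive eighth root of unity `ω = e ^ (i π / 4)`. -/
def omega : ℂ := Complex.exp (Complex.I * Real.pi / 4)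

/-- The Hadamard gate. -/
def hadamard : Matrix (Fin 2) (Fin 2) ℂ :=
  (1 / (Real.sqrt 2 : ℂ)) • !![1, 1; 1, -1]

/-- The phase gate. -/
def phase : Matrix (Fin 2) (Fin 2) ℂ := !![1, 0; 0, Complex.I]

/-- The `T` gate. -/
def tee : Matrix (Fin 2) (Fin 2) ℂ := !![1, 0; 0, Complex.exp (Complex.I * Real.pi / 4)]

/-- The one-qubit operator `A` applied to qubit `k` of `n` qubits, that is,
`I ⊗ ⋯ ⊗ I ⊗ A ⊗ I ⊗ ⋯ ⊗ I` with `A` in position `k`. -/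
def onQubit {n : ℕ} (A : Matrix (Fin 2) (Fin 2) ℂ) (k : Fin n) : Matrix (Basis n) (Basis n) ℂ :=
  Matrix.of fun x y => if ∀ j, j ≠ k → x j = y j then A (x k) (y k) else 0

/-- The controlled-not operator with control qubit `c` and target qubit `t`: it sends the basis
state `y` to the one in which bit `t` is replaced by `y t + y c` modulo `2`. -/
def cnot {n : ℕ} (c t : Fin n) : Matrix (Basis n) (Basis n) ℂ :=
  Matrix.of fun x y => if x = Function.update y t (y t + y c) then 1 else 0

/-- The Clifford+T gates on `n` qubits: the scalar `ω`, the gates `H`, `S`, `T` on any one qubit,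
and the controlled-not gate on any two distinct qubits. -/
inductive Gate (n : ℕ) : Type
  | scalar : Gate n
  | H (k : Fin n) : Gate n
  | S (k : Fin n) : Gate n
  | T (k : Fin n) : Gate n
  | CNOT (c t : Fin n) (hct : c ≠ t) : Gate n

/-- The operator of a gate. -/
def Gate.toMatrix {n : ℕ} : Gate n → Matrix (Basis n) (Basis n) ℂ
  | .scalar => omega • (1 : Matrix (Basis n) (Basis n) ℂ)
  | .H k => onQubit hadamard k
  | .S k => onQubit phase k
  | .T k => onQubit tee k
  | .CNOT c t _ => cnot c t

/-- An ancilla-free Clifford+T circuit on `n` qubits is a finite sequence of gates, listed in order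
of matrix multiplication. Every gate has finite order, so inverse gates need not be listed. -/
abbrev Circuit (n : ℕ) : Type := List (Gate n)

/-- The operator of a circuit, the product of its gates. -/
def Circuit.toMatrix {n : ℕ} (C : Circuit n) : Matrix (Basis n) (Basis n) ℂ :=
  (C.map Gate.toMatrix).prod

/-- The ring `ℤ[1/√2, i]`, as a subring of the complex numbers. -/
def ringZ : Subalgebra ℤ ℂ := Algebra.adjoin ℤ {1 / (Real.sqrt 2 : ℂ), Complex.I}

end CliffordT

end

namespace CliffordT

open Complex

/-! For (a) ⇒ (b), every gate has entries in `ringZ` and determinant a power of `ω ^ 2 ^ (n - 1)`,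
essentially because a one-qubit gate `A` has determinant `A.det ^ 2 ^ (n - 1)`; the four lists in
(b) are the groups generated by this root of unity (`det_condition_iff`). For (b) ⇒ (a), a power of
one `T` gate (of the scalar if `n = 0`) has the same determinant as `U`, so one may assume `det U =
1`. Columns are then reduced one at a time to basis vectors. Denominators are powers of the prime `δ
= 1 - ω` of `ℤ[ω]`, whose residue field has two elements. In a unit column with denominator `δ ^ (k
+ 1)`, an even number of numerators are odd. Units modulo `δ ^ 3` are powers of `ω`, so a two-level
conjugate of `i H` makes any two odd numerators even (`exists_hadamard_even`). At exponent `0` only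
a phase times a basis vector remains (`unit_vector_zomega`). No ancilla is needed because only
two-level operators of determinant `1` are used. The fully controlled `i X` is built from
commutators (`multicontrolled_I_pauliX_mem`), `i H` is a conjugate of `i X`, and CNOT conjugation
carries the operators to any pair of basis states (`FullyControllable.hasTwoLevel`). When all but
one basis vector are fixed, the determinant forces the identity. -/

/-! ### Arithmetic of the eighth root of unity. -/

theorem omega_eq : omega = (1 / (Real.sqrt 2 : ℂ)) * (1 + I) := by
  have h : Complex.I * Real.pi / 4 = ((Real.pi / 4 : ℝ) : ℂ) * I := by push_cast; ring
  rw [omega, h, exp_mul_I, ← ofReal_cos, ← ofReal_sin, Real.cos_pi_div_four, Real.sin_pi_div_four]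
  have h2 : ((Real.sqrt 2 : ℝ) : ℂ) ^ 2 = 2 := by
    rw [← ofReal_pow, Real.sq_sqrt (by norm_num)]; norm_num
  have h0 : ((Real.sqrt 2 : ℝ) : ℂ) ≠ 0 := by
    intro h; rw [h] at h2; norm_num at h2
  push_cast
  field_simp
  rw [h2]

theorem sqrt_two_sq : (Real.sqrt 2 : ℂ) ^ 2 = 2 := by
  rw [← ofReal_pow, Real.sq_sqrt (by norm_num)]; norm_num

theorem sqrt_two_ne_zero : (Real.sqrt 2 : ℂ) ≠ 0 := by
  intro h
  have := sqrt_two_sq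
  rw [h] at this
  norm_num at this

theorem omega_sq : omega ^ 2 = I := by
  have h0 := sqrt_two_ne_zero
  rw [omega_eq, mul_pow, div_pow, sqrt_two_sq]
  linear_combination (1 / 2 : ℂ) * I_sq

theorem omega_pow_four : omega ^ 4 = -1 := by
  linear_combination (omega ^ 2 + I) * omega_sq + I_sq

theorem omega_pow_eight : omega ^ 8 = 1 := by
  linear_combination (omega ^ 4 - 1) * omega_pow_four

theorem omega_ne_zero : omega ≠ 0 := by
  intro h
  have := omega_pow_four
  rw [h] at this
  norm_num at this

theorem sqrt_two_eq : (Real.sqrt 2 : ℂ) = omega - omega ^ 3 := by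
  have h0 := sqrt_two_ne_zero
  have h1 : omega - omega ^ 3 = omega * (1 - I) := by rw [← omega_sq]; ring
  rw [h1, omega_eq]
  field_simp
  linear_combination sqrt_two_sq + I_sq

theorem star_omega : star omega = omega ^ 7 := by
  have h1 : star omega = (1 / (Real.sqrt 2 : ℂ)) * (1 - I) := by
    rw [omega_eq]
    simp [sub_eq_add_neg]
  have h0 := sqrt_two_ne_zero
  have h2 : star omega * omega = 1 := by
    rw [h1, omega_eq]
    field_simp
    linear_combination -sqrt_two_sq - I_sq
  linear_combination (-star omega) * omega_pow_eight + omega ^ 7 * h2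

theorem star_omega_mul : star omega * omega = 1 := by
  rw [star_omega]
  linear_combination omega_pow_eight

/-! ### The ring `ℤ[ω]` in coordinates. -/

/-- The ring of integers `ℤ[ω]`. -/
noncomputable def zomega : Subalgebra ℤ ℂ := Algebra.adjoin ℤ {omega}

theorem omega_mem_zomega : omega ∈ zomega := Algebra.subset_adjoin rfl

theorem omega_pow_mem_zomega (k : ℕ) : omega ^ k ∈ zomega := pow_mem omega_mem_zomega k

theorem int_mem_zomega (a : ℤ) : (a : ℂ) ∈ zomega := intCast_mem _ a

theorem mem_zomega_iff {x : ℂ} : x ∈ zomega ↔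
    ∃ a b c d : ℤ, x = a + b * omega + c * omega ^ 2 + d * omega ^ 3 := by
  constructor
  · intro hx
    induction hx using Algebra.adjoin_induction with
    | mem x hx =>
      rw [Set.mem_singleton_iff] at hx
      exact ⟨0, 1, 0, 0, by simp [hx]⟩
    | algebraMap r => exact ⟨r, 0, 0, 0, by simp⟩
    | add x y _ _ hx hy =>
      obtain ⟨a, b, c, d, rfl⟩ := hx
      obtain ⟨a', b', c', d', rfl⟩ := hy
      exact ⟨a + a', b + b', c + c', d + d', by push_cast; ring⟩
    | mul x y _ _ hx hy =>
      obtain ⟨a, b, c, d, rfl⟩ := hx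
      obtain ⟨a', b', c', d', rfl⟩ := hy
      refine ⟨a * a' - b * d' - c * c' - d * b', a * b' + b * a' - c * d' - d * c',
        a * c' + b * b' + c * a' - d * d', a * d' + b * c' + c * b' + d * a', ?_⟩
      push_cast
      linear_combination ((b * d' + c * c' + d * b' : ℂ) + (c * d' + d * c') * omega
        + d * d' * omega ^ 2) * omega_pow_four
  · rintro ⟨a, b, c, d, rfl⟩
    have h := omega_pow_mem_zomega
    exact add_mem (add_mem (add_mem (int_mem_zomega a)
      (mul_mem (int_mem_zomega b) omega_mem_zomega))
      (mul_mem (int_mem_zomega c) (h 2))) (mul_mem (int_mem_zomega d) (h 3))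

theorem star_mem_zomega {x : ℂ} (hx : x ∈ zomega) : star x ∈ zomega := by
  obtain ⟨a, b, c, d, rfl⟩ := mem_zomega_iff.1 hx
  have h (k : ℕ) : star omega ^ k ∈ zomega := by
    rw [star_omega]; exact pow_mem (omega_pow_mem_zomega 7) k
  have : star ((a : ℂ) + b * omega + c * omega ^ 2 + d * omega ^ 3)
      = a + b * star omega ^ 1 + c * star omega ^ 2 + d * star omega ^ 3 := by simp
  rw [this]
  exact add_mem (add_mem (add_mem (int_mem_zomega a)
      (mul_mem (int_mem_zomega b) (h 1)))
      (mul_mem (int_mem_zomega c) (h 2))) (mul_mem (int_mem_zomega d) (h 3))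

/-- The squared modulus of an element of `ℤ[ω]`, as an element of `ℤ[√2]`. -/
theorem star_mul_self_zomega (a b c d : ℤ) :
    star ((a : ℂ) + b * omega + c * omega ^ 2 + d * omega ^ 3)
      * (a + b * omega + c * omega ^ 2 + d * omega ^ 3)
      = ((((a ^ 2 + b ^ 2 + c ^ 2 + d ^ 2 : ℤ) : ℝ)
        + ((a * b + b * c + c * d - d * a : ℤ) : ℝ) * Real.sqrt 2 : ℝ) : ℂ) := by
  have h : star ((a : ℂ) + b * omega + c * omega ^ 2 + d * omega ^ 3)
      = a - b * omega ^ 3 - c * omega ^ 2 - d * omega := by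
    have h7 : omega ^ 7 = -omega ^ 3 := by linear_combination omega ^ 3 * omega_pow_four
    simp only [star_add, star_mul', star_pow, star_omega, h7, star_intCast]
    linear_combination (c * omega ^ 2 - d * omega * (omega ^ 4 - 1)) * omega_pow_four
  rw [h]
  push_cast
  rw [sqrt_two_eq]
  linear_combination (-(b : ℂ) ^ 2 - c ^ 2 - d ^ 2 - b * c * omega - b * d * omega ^ 2
    - c * d * omega) * omega_pow_four

/-- Uniqueness of coordinates in `ℤ[√2]`. -/
theorem int_add_mul_sqrt_two_inj {a b c d : ℤ}
    (h : (a : ℝ) + b * Real.sqrt 2 = c + d * Real.sqrt 2) : a = c ∧ b = d := by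
  have hbd : b = d := by
    by_contra hne
    have hne' : b - d ≠ 0 := sub_ne_zero.2 hne
    refine (irrational_sqrt_two.intCast_mul hne').ne_int (c - a) ?_
    push_cast
    linarith
  subst hbd
  refine ⟨?_, rfl⟩
  have : (a : ℝ) = c := by linarith
  exact_mod_cast this

/-! ### Congruences modulo powers of `δ`. -/

/-- The prime of `ℤ[ω]` above `2`. -/
noncomputable def delta : ℂ := 1 - omega

theorem delta_mem_zomega : delta ∈ zomega := sub_mem (one_mem _) omega_mem_zomega

theorem omega_eq_one_sub_delta : omega = 1 - delta := by simp [delta]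

/-- `δ ^ 2 = -ω √2 (√2 - 1)`, and `√2 - 1` is a unit with inverse `1 + √2`. Hence `δ ^ 2` is
associate to `√2` and `δ ^ 4` to `2`. -/
theorem exists_two_eq_delta_pow : ∃ u ∈ zomega, (2 : ℂ) = delta ^ 4 * u := by
  refine ⟨-(omega ^ 2) * (1 + omega - omega ^ 3) ^ 2, ?_, ?_⟩
  · have h := omega_pow_mem_zomega
    exact mul_mem (neg_mem (h 2))
      (pow_mem (sub_mem (add_mem (one_mem _) omega_mem_zomega) (h 3)) 2)
  · have hs := sqrt_two_sq
    rw [sqrt_two_eq] at hs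
    have h1 : delta ^ 2 = -omega * (2 - (omega - omega ^ 3)) := by
      rw [delta]; linear_combination omega_pow_four
    have h2 : (2 : ℂ) - (omega - omega ^ 3) = (omega - omega ^ 3) * ((omega - omega ^ 3) - 1) := by
      linear_combination -hs
    have h3 : ((omega - omega ^ 3) - 1) * (1 + omega - omega ^ 3) = 1 := by
      linear_combination hs
    calc (2 : ℂ) = -(omega ^ 4) * 2 := by rw [omega_pow_four]; ring
      _ = -(omega ^ 4) * (omega - omega ^ 3) ^ 2 *
          (((omega - omega ^ 3) - 1) * (1 + omega - omega ^ 3)) ^ 2 := by rw [h3, hs]; ring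
      _ = (delta ^ 2) ^ 2 * (-(omega ^ 2) * (1 + omega - omega ^ 3) ^ 2) := by
        rw [h1, h2]; ring
      _ = _ := by ring

theorem delta_sq_div_sqrt_two : delta ^ 2 / (Real.sqrt 2 : ℂ) ∈ zomega := by
  have hs := sqrt_two_sq
  have : delta ^ 2 / (Real.sqrt 2 : ℂ) = omega * (1 - (omega - omega ^ 3)) := by
    rw [div_eq_iff sqrt_two_ne_zero]
    rw [sqrt_two_eq] at hs ⊢
    rw [delta]
    linear_combination omega * hs + omega_pow_four
  rw [this]
  have h := omega_pow_mem_zomega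
  exact mul_mem omega_mem_zomega (sub_mem (one_mem _) (sub_mem omega_mem_zomega (h 3)))

theorem delta_ne_zero : delta ≠ 0 := by
  obtain ⟨u, -, h⟩ := exists_two_eq_delta_pow
  intro h0
  rw [h0] at h
  norm_num at h

theorem two_mem_delta : ∃ w ∈ zomega, (2 : ℂ) = delta * w := by
  obtain ⟨u, hu, h⟩ := exists_two_eq_delta_pow
  exact ⟨delta ^ 3 * u, mul_mem (pow_mem delta_mem_zomega 3) hu, by rw [h]; ring⟩

/-- `δ` is not a unit: `|δ|² = 2 - √2`, and `(2 - √2)(p + q √2)` has the even rational part `2p -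
2q`, so it is not `1`. -/
theorem one_ne_delta_mul {w : ℂ} (hw : w ∈ zomega) : delta * w ≠ 1 := by
  intro h
  obtain ⟨a, b, c, d, rfl⟩ := mem_zomega_iff.1 hw
  have h1 := congrArg (fun z => star z * z) h
  simp only [star_mul', star_one, one_mul] at h1
  have hd : star delta * delta = ((2 - Real.sqrt 2 : ℝ) : ℂ) := by
    have := star_mul_self_zomega 1 (-1) 0 0
    norm_num [← sub_eq_add_neg] at this
    rw [delta]
    simpa [sub_eq_add_neg] using this
  have h2 : (star delta * delta) * (star ((a : ℂ) + b * omega + c * omega ^ 2 + d * omega ^ 3)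
      * (a + b * omega + c * omega ^ 2 + d * omega ^ 3)) = 1 := by
    rw [← h1]; ring
  rw [hd, star_mul_self_zomega, ← ofReal_mul] at h2
  have h3 := ofReal_eq_one.1 h2
  generalize a ^ 2 + b ^ 2 + c ^ 2 + d ^ 2 = p at h3
  generalize a * b + b * c + c * d - d * a = q at h3
  have h4 : ((2 * p - 2 * q : ℤ) : ℝ) + ((2 * q - p : ℤ) : ℝ) * Real.sqrt 2
      = ((1 : ℤ) : ℝ) + ((0 : ℤ) : ℝ) * Real.sqrt 2 := by
    have := Real.sq_sqrt (show (0 : ℝ) ≤ 2 by norm_num)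
    push_cast
    linear_combination h3 + (q : ℝ) * this
  have := (int_add_mul_sqrt_two_inj h4).1
  omega

/-- Since `ω ≡ 1` modulo `δ`, an element is congruent to the sum of its four coordinates, and `δ`
divides `2`. -/
theorem zomega_parity {x : ℂ} (hx : x ∈ zomega) :
    ∃ w ∈ zomega, x = delta * w ∨ x = 1 + delta * w := by
  obtain ⟨a, b, c, d, rfl⟩ := mem_zomega_iff.1 hx
  obtain ⟨u, hu, h2⟩ := two_mem_delta
  have key (m : ℤ) : ((-b - c * (1 + omega) - d * (1 + omega + omega ^ 2) : ℂ) + m * u) ∈ zomega := by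
    have h := omega_pow_mem_zomega
    have h1 : 1 + omega ∈ zomega := add_mem (one_mem _) omega_mem_zomega
    exact add_mem (sub_mem (sub_mem (neg_mem (int_mem_zomega b)) (mul_mem (int_mem_zomega c) h1))
      (mul_mem (int_mem_zomega d) (add_mem h1 (h 2)))) (mul_mem (int_mem_zomega m) hu)
  rcases Int.even_or_odd' (a + b + c + d) with ⟨m, hm | hm⟩
  · refine ⟨_, key m, Or.inl ?_⟩
    have hm' : (a + b + c + d : ℂ) = 2 * m := by exact_mod_cast hm
    rw [delta] at *
    linear_combination hm' + m * h2
  · refine ⟨_, key m, Or.inr ?_⟩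
    have hm' : (a + b + c + d : ℂ) = 2 * m + 1 := by exact_mod_cast hm
    rw [delta] at *
    linear_combination hm' + m * h2

/-- Every unit of `ℤ[ω] / δ³` is a power of `ω`. -/
theorem odd_eq_omega_pow {x : ℂ} (hx : x ∈ zomega) (hodd : ∀ w ∈ zomega, x ≠ delta * w) :
    ∃ m : ℕ, ∃ w ∈ zomega, x = omega ^ m + delta ^ 3 * w := by
  obtain ⟨x₁, hx₁, h | h⟩ := zomega_parity hx
  · exact absurd h (hodd _ hx₁)
  obtain ⟨u, hu, h2⟩ := exists_two_eq_delta_pow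
  have hd := delta_mem_zomega
  have hdu : delta ^ 2 * u ∈ zomega := mul_mem (pow_mem hd 2) hu
  have hω := omega_eq_one_sub_delta
  -- The next two `δ`-adic digits of `x` give four classes. As `2 ≡ 0` modulo `δ ^ 3`, these are
  -- `1`, `1 + δ ^ 2 ≡ ω ^ 2`, `1 + δ ≡ ω` and `1 + δ + δ ^ 2 ≡ ω ^ 3`.
  obtain ⟨x₂, hx₂, h₁ | h₁⟩ := zomega_parity hx₁ <;>
    obtain ⟨x₃, hx₃, h₂ | h₂⟩ := zomega_parity hx₂
  · exact ⟨0, x₃, hx₃, by rw [h, h₁, h₂]; ring⟩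
  · refine ⟨2, x₃ + delta ^ 2 * u, add_mem hx₃ hdu, ?_⟩
    rw [h, h₁, h₂, hω]
    linear_combination delta * h2
  · refine ⟨1, x₃ + delta ^ 2 * u, add_mem hx₃ hdu, ?_⟩
    rw [h, h₁, h₂, hω]
    linear_combination delta * h2
  · refine ⟨3, x₃ + 1 + (2 - delta) * (delta ^ 2 * u), add_mem (add_mem hx₃ (one_mem _))
      (mul_mem (sub_mem (ofNat_mem _ 2) hd) hdu), ?_⟩
    rw [h, h₁, h₂, hω]
    linear_combination (2 - delta) * delta * h2

theorem odd_ratio {a b : ℂ} (ha : a ∈ zomega) (hb : b ∈ zomega)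
    (hao : ∀ w ∈ zomega, a ≠ delta * w) (hbo : ∀ w ∈ zomega, b ≠ delta * w) :
    ∃ k : ℕ, ∃ w ∈ zomega, b = omega ^ k * a + delta ^ 3 * w := by
  obtain ⟨m, a', ha', rfl⟩ := odd_eq_omega_pow ha hao
  obtain ⟨l, b', hb', rfl⟩ := odd_eq_omega_pow hb hbo
  -- `7 * m` stands for the exponent `-m` modulo `8`.
  refine ⟨l + 7 * m, b' - omega ^ (l + 7 * m) * a',
    sub_mem hb' (mul_mem (omega_pow_mem_zomega _) ha'), ?_⟩
  have : omega ^ (l + 7 * m) * omega ^ m = omega ^ l := by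
    rw [← pow_add, add_assoc, show 7 * m + m = 8 * m by ring, pow_add, pow_mul omega 8,
      omega_pow_eight, one_pow, mul_one]
  linear_combination -this

theorem star_omega_pow_mul (k : ℕ) : star omega ^ k * omega ^ k = 1 := by
  rw [← mul_pow, star_omega_mul, one_pow]

/-- A suitable conjugate of `i H` makes a pair of odd elements of `ℤ[ω]` even. -/
theorem exists_hadamard_even {a b : ℂ} (ha : a ∈ zomega) (hb : b ∈ zomega)
    (hao : ∀ w ∈ zomega, a ≠ delta * w) (hbo : ∀ w ∈ zomega, b ≠ delta * w) :
    ∃ k : ℕ, (∃ w ∈ zomega, I / (Real.sqrt 2 : ℂ) * (a + star omega ^ k * b) = delta * w) ∧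
      ∃ w ∈ zomega, I / (Real.sqrt 2 : ℂ) * (omega ^ k * a - b) = delta * w := by
  obtain ⟨k, w, hw, h⟩ := odd_ratio ha hb hao hbo
  obtain ⟨u, hu, h2⟩ := exists_two_eq_delta_pow
  have hI : I ∈ zomega := omega_sq ▸ omega_pow_mem_zomega 2
  have hq := delta_sq_div_sqrt_two
  have hs : star omega ^ k ∈ zomega := pow_mem (star_mem_zomega omega_mem_zomega) k
  have h1 := star_omega_pow_mul k
  have h0 := sqrt_two_ne_zero
  -- With `b ≡ ω ^ k a` modulo `δ ^ 3`, both combinations are divisible by `δ ^ 3` (for the first,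
  -- `δ ^ 4` divides `2 a`). Dividing by `√2`, an associate of `δ ^ 2`, leaves a factor `δ`.
  refine ⟨k, ⟨I * (delta ^ 2 / (Real.sqrt 2 : ℂ)) * (delta * u * a + star omega ^ k * w), ?_, ?_⟩,
    ⟨-(I * (delta ^ 2 / (Real.sqrt 2 : ℂ)) * w), ?_, ?_⟩⟩
  · exact mul_mem (mul_mem hI hq) (add_mem (mul_mem (mul_mem delta_mem_zomega hu) ha)
      (mul_mem hs hw))
  · have : a + star omega ^ k * b = delta ^ 3 * (delta * u * a + star omega ^ k * w) := by
      rw [h]; linear_combination a * h1 + a * h2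
    rw [this]; ring
  · exact neg_mem (mul_mem (mul_mem hI hq) hw)
  · have : omega ^ k * a - b = -(delta ^ 3 * w) := by rw [h]; ring
    rw [this]; ring

/-! ### Denominators, unit vectors and parity. -/

theorem inv_sqrt_two_mem_ringZ : 1 / (Real.sqrt 2 : ℂ) ∈ ringZ :=
  Algebra.subset_adjoin (Set.mem_insert _ _)

theorem I_mem_ringZ : I ∈ ringZ :=
  Algebra.subset_adjoin (Set.mem_insert_of_mem _ rfl)

theorem omega_mem_ringZ : omega ∈ ringZ := by
  rw [omega_eq]
  exact mul_mem inv_sqrt_two_mem_ringZ (add_mem (one_mem _) I_mem_ringZ)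

theorem exists_delta_pow_mul_mem {x : ℂ} (hx : x ∈ ringZ) : ∃ k : ℕ, delta ^ k * x ∈ zomega := by
  induction hx using Algebra.adjoin_induction with
  | mem x hx =>
    rcases hx with rfl | rfl
    · exact ⟨2, by simpa [div_eq_mul_inv] using delta_sq_div_sqrt_two⟩
    · exact ⟨0, by simpa using omega_sq ▸ omega_pow_mem_zomega 2⟩
  | algebraMap r => exact ⟨0, by simp⟩
  | add x y _ _ hx hy =>
    obtain ⟨k, hk⟩ := hx
    obtain ⟨l, hl⟩ := hy
    refine ⟨k + l, ?_⟩
    have : delta ^ (k + l) * (x + y) = delta ^ l * (delta ^ k * x) + delta ^ k * (delta ^ l * y) := by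
      ring
    rw [this]
    exact add_mem (mul_mem (pow_mem delta_mem_zomega _) hk) (mul_mem (pow_mem delta_mem_zomega _) hl)
  | mul x y _ _ hx hy =>
    obtain ⟨k, hk⟩ := hx
    obtain ⟨l, hl⟩ := hy
    refine ⟨k + l, ?_⟩
    have : delta ^ (k + l) * (x * y) = (delta ^ k * x) * (delta ^ l * y) := by ring
    rw [this]
    exact mul_mem hk hl

theorem exists_delta_pow_mul_mem_pi {ι : Type*} [Fintype ι] {v : ι → ℂ}
    (hv : ∀ z, v z ∈ ringZ) : ∃ k : ℕ, ∀ z, delta ^ k * v z ∈ zomega := by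
  choose k hk using fun z => exists_delta_pow_mul_mem (hv z)
  refine ⟨∑ z, k z, fun z => ?_⟩
  obtain ⟨l, hl⟩ := Nat.exists_eq_add_of_le
    (Finset.single_le_sum (f := k) (fun _ _ => Nat.zero_le _) (Finset.mem_univ z))
  rw [hl, pow_add, mul_comm (delta ^ k z), mul_assoc]
  exact mul_mem (pow_mem delta_mem_zomega _) (hk z)

/-- A unit vector over `ℤ[ω]` is a basis vector up to a power of `ω`. -/
theorem unit_vector_zomega {ι : Type*} [Fintype ι] [DecidableEq ι] {v : ι → ℂ}
    (hv : ∀ z, v z ∈ zomega) (hn : ∑ z, star (v z) * v z = 1) :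
    ∃ y, ∃ m : ℕ, v = Pi.single y (omega ^ m) := by
  choose a b c d h using fun z => mem_zomega_iff.1 (hv z)
  -- The rational part of the squared norm is a sum of integer squares equal to `1`, so exactly one
  -- coordinate of one entry is nonzero, and it is `±1`.
  have h1 : ∑ z, (a z ^ 2 + b z ^ 2 + c z ^ 2 + d z ^ 2) = 1 := by
    simp only [h, star_mul_self_zomega] at hn
    rw [ ← ofReal_sum, ofReal_eq_one, Finset.sum_add_distrib,
      ← Finset.sum_mul, ← Int.cast_sum, ← Int.cast_sum] at hn
    exact (int_add_mul_sqrt_two_inj (hn.trans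
      (by simp : (1 : ℝ) = ((1 : ℤ) : ℝ) + ((0 : ℤ) : ℝ) * Real.sqrt 2))).1
  have hnn : ∀ z, 0 ≤ a z ^ 2 + b z ^ 2 + c z ^ 2 + d z ^ 2 := fun z => by positivity
  obtain ⟨y, hy⟩ : ∃ y, 0 < a y ^ 2 + b y ^ 2 + c y ^ 2 + d y ^ 2 := by
    by_contra! hcon
    have := Finset.sum_nonpos fun z (_ : z ∈ Finset.univ) => hcon z
    omega
  have hsplit := Finset.add_sum_erase Finset.univ
    (fun z => a z ^ 2 + b z ^ 2 + c z ^ 2 + d z ^ 2) (Finset.mem_univ y)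
  have hrest : ∑ z ∈ Finset.univ.erase y, (a z ^ 2 + b z ^ 2 + c z ^ 2 + d z ^ 2) = 0 := by
    have := Finset.sum_nonneg fun z (_ : z ∈ Finset.univ.erase y) => hnn z
    omega
  have hy1 : a y ^ 2 + b y ^ 2 + c y ^ 2 + d y ^ 2 = 1 := by
    omega
  have hz : ∀ z, z ≠ y → v z = 0 := by
    intro z hzy
    have h0 := (Finset.sum_eq_zero_iff_of_nonneg fun z _ => hnn z).1 hrest z
      (Finset.mem_erase.2 ⟨hzy, Finset.mem_univ z⟩)
    have ha : a z = 0 := by nlinarith [sq_nonneg (a z), sq_nonneg (b z), sq_nonneg (c z), sq_nonneg (d z)]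
    have hb : b z = 0 := by nlinarith [sq_nonneg (a z), sq_nonneg (b z), sq_nonneg (c z), sq_nonneg (d z)]
    have hc : c z = 0 := by nlinarith [sq_nonneg (a z), sq_nonneg (b z), sq_nonneg (c z), sq_nonneg (d z)]
    have hd : d z = 0 := by nlinarith [sq_nonneg (a z), sq_nonneg (b z), sq_nonneg (c z), sq_nonneg (d z)]
    rw [h z, ha, hb, hc, hd]
    simp
  obtain ⟨m, hm⟩ : ∃ m : ℕ, v y = omega ^ m := by
    rw [h y]
    generalize a y = p at *
    generalize b y = q at *
    generalize c y = r at *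
    generalize d y = s at *
    have bound : ∀ t : ℤ, t ^ 2 ≤ 1 → t = -1 ∨ t = 0 ∨ t = 1 := by
      intro t ht
      have h1 : -1 ≤ t := by nlinarith
      have h2 : t ≤ 1 := by nlinarith
      omega
    have h4 := omega_pow_four
    rcases bound p (by nlinarith [sq_nonneg q, sq_nonneg r, sq_nonneg s]) with rfl | rfl | rfl <;>
    rcases bound q (by nlinarith [sq_nonneg r, sq_nonneg s]) with rfl | rfl | rfl <;>
    rcases bound r (by nlinarith [sq_nonneg s]) with rfl | rfl | rfl <;>
    rcases bound s (by nlinarith) with rfl | rfl | rfl <;>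
    first
    | (exfalso; norm_num at hy1; done)
    | exact ⟨0, by push_cast; ring1⟩
    | exact ⟨1, by push_cast; ring1⟩
    | exact ⟨2, by push_cast; ring1⟩
    | exact ⟨3, by push_cast; ring1⟩
    | exact ⟨4, by push_cast; linear_combination -h4⟩
    | exact ⟨5, by push_cast; linear_combination -omega * h4⟩
    | exact ⟨6, by push_cast; linear_combination -omega ^ 2 * h4⟩
    | exact ⟨7, by push_cast; linear_combination -omega ^ 3 * h4⟩
  refine ⟨y, m, funext fun z => ?_⟩
  by_cases hzy : z = y
  · subst hzy; simp [hm]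
  · simp [hzy, hz z hzy]

/-- The number of entries of a vector over `ℤ[ω]` not divisible by `δ` is even if its squared norm
is divisible by `δ`. -/
theorem even_card_odd {ι : Type*} [Fintype ι] {v : ι → ℂ} {s : Finset ι}
    (hv : ∀ z, v z ∈ zomega) (hs : ∀ z, z ∈ s ↔ ∀ w ∈ zomega, v z ≠ delta * w)
    (hn : ∃ w ∈ zomega, ∑ z, star (v z) * v z = delta * w) : Even s.card := by
  classical
  have hsd : ∃ w ∈ zomega, star delta = delta * w := by
    refine ⟨-omega ^ 7, neg_mem (omega_pow_mem_zomega 7), ?_⟩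
    rw [delta, star_sub, star_omega, star_one]
    linear_combination -omega_pow_eight
  obtain ⟨e, he, hse⟩ := hsd
  -- `star δ` is a multiple of `δ`, so conjugation preserves parity and each odd entry contributes
  -- `1` modulo `δ`. An odd count would make `1` a multiple of `δ`.
  have key : ∀ z, ∃ w ∈ zomega, star (v z) * v z = (if z ∈ s then 1 else 0) + delta * w := by
    intro z
    have hst := star_mem_zomega (hv z)
    by_cases hz : z ∈ s
    · obtain ⟨w, hw, h | h⟩ := zomega_parity (hv z)
      · exact absurd h ((hs z).1 hz w hw)
      · have hsw := star_mem_zomega hw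
        refine ⟨w + e * star w * v z, add_mem hw (mul_mem (mul_mem he hsw) (hv z)), ?_⟩
        rw [if_pos hz]
        have : star (v z) = 1 + delta * e * star w := by
          rw [h, star_add, star_mul', star_one, hse]
        rw [this]
        linear_combination h
    · have := mt (hs z).2 hz
      push Not at this
      obtain ⟨w, hw, h⟩ := this
      refine ⟨star (v z) * w, mul_mem hst hw, ?_⟩
      rw [if_neg hz]
      linear_combination star (v z) * h
  choose f hf hfe using key
  obtain ⟨w, hw, hn⟩ := hn
  rw [Finset.sum_congr rfl fun z _ => hfe z, Finset.sum_add_distrib, ← Finset.mul_sum] at hn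
  by_contra hodd
  obtain ⟨m, hm⟩ := Nat.not_even_iff_odd.1 hodd
  obtain ⟨u, hu, h2⟩ := two_mem_delta
  have hc : (∑ z, if z ∈ s then (1 : ℂ) else 0) = 2 * m + 1 := by
    simp [hm]
  have hmz : (m : ℂ) ∈ zomega := natCast_mem _ m
  refine one_ne_delta_mul (w := w - ∑ z, f z - m * u)
    (sub_mem (sub_mem hw (sum_mem fun z _ => hf z)) (mul_mem hmz hu)) ?_
  rw [hc] at hn
  linear_combination -hn + m * h2

/-! ### Gates as block-diagonal operators, one block per setting of the other bits. -/

open Matrix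

/-- The bits of the qubits other than `t`. -/
abbrev Rest {n : ℕ} (t : Fin n) : Type := {j : Fin n // j ≠ t} → Fin 2

/-- The operator that applies to qubit `t` a one-qubit operator selected by the other bits. -/
noncomputable def multiplexer {n : ℕ} (t : Fin n) :
    (Rest t → Matrix (Fin 2) (Fin 2) ℂ) →+* Matrix (Basis n) (Basis n) ℂ :=
  (reindexAlgEquiv ℂ ℂ (Equiv.funSplitAt t (Fin 2)).symm).toRingEquiv.toRingHom.comp
    (blockDiagonalRingHom (Fin 2) (Rest t) ℂ)

variable {n : ℕ}

theorem multiplexer_apply (t : Fin n) (f : Rest t → Matrix (Fin 2) (Fin 2) ℂ) (x y : Basis n) :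
    multiplexer t f x y =
      if (fun j : {j // j ≠ t} => x j) = (fun j : {j // j ≠ t} => y j)
        then f (fun j => x j) (x t) (y t) else 0 := by
  simp [multiplexer, blockDiagonal_apply, Equiv.funSplitAt, Equiv.piSplitAt]

theorem star_multiplexer (t : Fin n) (f : Rest t → Matrix (Fin 2) (Fin 2) ℂ) :
    star (multiplexer t f) = multiplexer t (star f) := by
  ext x y
  rw [star_apply, multiplexer_apply, multiplexer_apply]
  by_cases h : (fun j : {j // j ≠ t} => x j) = (fun j : {j // j ≠ t} => y j)
  · rw [if_pos h, if_pos h.symm, ← h]; rfl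
  · rw [if_neg h, if_neg (Ne.symm h), star_zero]

theorem det_multiplexer (t : Fin n) (f : Rest t → Matrix (Fin 2) (Fin 2) ℂ) :
    (multiplexer t f).det = ∏ r, (f r).det := by
  simp only [multiplexer, RingHom.comp_apply]
  exact (det_reindexAlgEquiv ℂ ℂ _ _).trans (det_blockDiagonal _)

theorem onQubit_eq_multiplexer (A : Matrix (Fin 2) (Fin 2) ℂ) (t : Fin n) :
    onQubit A t = multiplexer t fun _ => A := by
  ext x y
  rw [multiplexer_apply, onQubit, of_apply]
  congr 1
  simp [funext_iff]

/-- The Pauli matrix `X`. -/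
def pauliX : Matrix (Fin 2) (Fin 2) ℂ := !![0, 1; 1, 0]

theorem cnot_eq_multiplexer {c t : Fin n} (h : c ≠ t) :
    cnot c t = multiplexer t fun r => if r ⟨c, h⟩ = 1 then pauliX else 1 := by
  ext x y
  rw [multiplexer_apply, cnot, of_apply]
  by_cases hr : (fun j : {j // j ≠ t} => x j) = (fun j : {j // j ≠ t} => y j)
  · have hc : x c = y c := congrFun hr ⟨c, h⟩
    have hxy : x = Function.update y t (y t + y c) ↔ x t = y t + y c := by
      constructor
      · intro e
        simpa using congrFun e t
      · intro e
        ext j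
        by_cases hj : j = t
        · subst hj; rw [e, Function.update_self]
        · rw [Function.update_of_ne hj]; exact congrArg Fin.val (congrFun hr ⟨j, hj⟩)
    rw [if_pos hr]
    simp only [hxy, hc]
    generalize x t = a
    generalize y t = b
    generalize y c = d
    fin_cases a <;> fin_cases b <;> fin_cases d <;> simp [pauliX]
  · rw [if_neg hr, if_neg]
    rintro rfl
    apply hr
    ext j
    simp [j.2]

/-! ### The Clifford+T group and its closure under inverses. -/

/-- The ancilla-free Clifford+T group on `n` qubits. -/
def cliffordT (n : ℕ) : Submonoid (Matrix (Basis n) (Basis n) ℂ) :=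
  Submonoid.closure (Set.range Gate.toMatrix)

theorem mem_cliffordT_iff {M : Matrix (Basis n) (Basis n) ℂ} :
    M ∈ cliffordT n ↔ ∃ C : Circuit n, C.toMatrix = M := by
  constructor
  · intro h
    obtain ⟨l, hl, rfl⟩ := Submonoid.exists_list_of_mem_closure h
    have : l ∈ Set.range (List.map (Gate.toMatrix (n := n))) := by
      rw [Set.range_list_map]; exact hl
    obtain ⟨C, rfl⟩ := this
    exact ⟨C, rfl⟩
  · rintro ⟨C, rfl⟩
    refine list_prod_mem fun M hM => ?_
    obtain ⟨g, -, rfl⟩ := List.mem_map.1 hM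
    exact Submonoid.subset_closure ⟨g, rfl⟩

theorem gate_mem (g : Gate n) : g.toMatrix ∈ cliffordT n := Submonoid.subset_closure ⟨g, rfl⟩

theorem tee_eq : tee = !![1, 0; 0, omega] := rfl

theorem star_of_fin_two (a b c d : ℂ) :
    star !![a, b; c, d] = !![star a, star c; star b, star d] := by
  ext i j
  fin_cases i <;> fin_cases j <;> rfl

theorem star_hadamard : star hadamard = hadamard := by
  ext i j
  fin_cases i <;> fin_cases j <;> simp [hadamard, star_apply]

theorem hadamard_mul_self : hadamard * hadamard = 1 := by
  have h0 := sqrt_two_ne_zero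
  have h2 := sqrt_two_sq
  ext i j
  fin_cases i <;> fin_cases j <;> simp [hadamard, one_apply] <;> field_simp <;>
    rw [h2] <;> norm_num

theorem star_phase_mul : star phase * phase = 1 := by
  ext i j
  fin_cases i <;> fin_cases j <;> simp [phase, mul_apply, star_apply]

theorem star_tee_mul : star tee * tee = 1 := by
  have h : (starRingEnd ℂ) omega * omega = 1 := star_omega_mul
  ext i j
  fin_cases i <;> fin_cases j <;> simp [tee_eq, mul_apply, star_apply, h]

theorem star_pauliX : star pauliX = pauliX := by
  ext i j
  fin_cases i <;> fin_cases j <;> simp [pauliX, star_apply]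

theorem pauliX_mul_self : pauliX * pauliX = 1 := by
  ext i j
  fin_cases i <;> fin_cases j <;> simp [pauliX]

theorem phase_pow_eight : phase ^ 8 = 1 := by
  have h : phase = diagonal ![1, I] := by
    ext i j; fin_cases i <;> fin_cases j <;> simp [phase]
  have h8 : I ^ 8 = 1 := by rw [show I ^ 8 = (I ^ 2) ^ 4 by ring, I_sq]; norm_num
  rw [h, diagonal_pow, ← diagonal_one]
  congr 1
  ext i
  fin_cases i <;> simp [h8]

theorem tee_pow_eight : tee ^ 8 = 1 := by
  have h : tee = diagonal ![1, omega] := by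
    ext i j; fin_cases i <;> fin_cases j <;> simp [tee_eq]
  rw [h, diagonal_pow, ← diagonal_one]
  congr 1
  ext i
  fin_cases i <;> simp [omega_pow_eight]

theorem multiplexer_star_mul {t : Fin n} {f : Rest t → Matrix (Fin 2) (Fin 2) ℂ}
    (h : ∀ r, star (f r) * f r = 1) : star (multiplexer t f) * multiplexer t f = 1 := by
  rw [star_multiplexer, ← map_mul, show star f * f = 1 from funext h, map_one]

theorem multiplexer_pow_eight {t : Fin n} {f : Rest t → Matrix (Fin 2) (Fin 2) ℂ}
    (h : ∀ r, f r ^ 8 = 1) : multiplexer t f ^ 8 = 1 := by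
  rw [← map_pow, show f ^ 8 = 1 from funext h, map_one]

theorem Gate.star_mul_self (g : Gate n) : star g.toMatrix * g.toMatrix = 1 := by
  have hH : star hadamard * hadamard = 1 := by rw [star_hadamard, hadamard_mul_self]
  cases g with
  | scalar =>
    simp only [Gate.toMatrix, star_smul, star_one, smul_mul_smul_comm, star_omega_mul, one_smul,
      mul_one]
  | H k => rw [Gate.toMatrix, onQubit_eq_multiplexer]; exact multiplexer_star_mul fun _ => hH
  | S k =>
    rw [Gate.toMatrix, onQubit_eq_multiplexer]; exact multiplexer_star_mul fun _ => star_phase_mul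
  | T k =>
    rw [Gate.toMatrix, onQubit_eq_multiplexer]; exact multiplexer_star_mul fun _ => star_tee_mul
  | CNOT c t h =>
    rw [Gate.toMatrix, cnot_eq_multiplexer h]
    refine multiplexer_star_mul fun r => ?_
    split_ifs
    · rw [star_pauliX, pauliX_mul_self]
    · rw [star_one, mul_one]

theorem Gate.pow_eight (g : Gate n) : g.toMatrix ^ 8 = 1 := by
  cases g with
  | scalar => rw [Gate.toMatrix, smul_pow, one_pow, omega_pow_eight, one_smul]
  | H k =>
    rw [Gate.toMatrix, onQubit_eq_multiplexer]
    refine multiplexer_pow_eight fun _ => ?_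
    rw [pow_mul hadamard 2 4, sq, hadamard_mul_self, one_pow]
  | S k =>
    rw [Gate.toMatrix, onQubit_eq_multiplexer]; exact multiplexer_pow_eight fun _ => phase_pow_eight
  | T k =>
    rw [Gate.toMatrix, onQubit_eq_multiplexer]; exact multiplexer_pow_eight fun _ => tee_pow_eight
  | CNOT c t h =>
    rw [Gate.toMatrix, cnot_eq_multiplexer h]
    refine multiplexer_pow_eight fun r => ?_
    split_ifs
    · rw [pow_mul pauliX 2 4, sq, pauliX_mul_self, one_pow]
    · rw [one_pow]

theorem cliffordT_star_mul_self {M : Matrix (Basis n) (Basis n) ℂ} (hM : M ∈ cliffordT n) :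
    star M * M = 1 := by
  induction hM using Submonoid.closure_induction with
  | mem M h => obtain ⟨g, rfl⟩ := h; exact g.star_mul_self
  | one => rw [star_one, mul_one]
  | mul M N _ _ hM hN =>
    rw [star_mul, mul_assoc, ← mul_assoc (star M), hM, one_mul, hN]

theorem cliffordT_mul_star_self {M : Matrix (Basis n) (Basis n) ℂ} (hM : M ∈ cliffordT n) :
    M * star M = 1 := mul_eq_one_comm.1 (cliffordT_star_mul_self hM)

theorem star_mem_cliffordT {M : Matrix (Basis n) (Basis n) ℂ} (hM : M ∈ cliffordT n) :
    star M ∈ cliffordT n := by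
  induction hM using Submonoid.closure_induction with
  | mem M h =>
    obtain ⟨g, rfl⟩ := h
    have : star g.toMatrix = g.toMatrix ^ 7 := by
      calc star g.toMatrix = star g.toMatrix * (g.toMatrix * g.toMatrix ^ 7) := by
            rw [← pow_succ', g.pow_eight, mul_one]
        _ = g.toMatrix ^ 7 := by rw [← mul_assoc, g.star_mul_self, one_mul]
    rw [this]
    exact pow_mem (gate_mem g) 7
  | one => rw [star_one]; exact one_mem _
  | mul M N _ _ hM hN => rw [star_mul]; exact mul_mem hN hM

/-! ### Multiply-controlled gates -/

theorem hadamard_mem (t : Fin n) : multiplexer t (fun _ => hadamard) ∈ cliffordT n := by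
  rw [← onQubit_eq_multiplexer]; exact gate_mem (.H t)

theorem phase_mem (t : Fin n) : multiplexer t (fun _ => phase) ∈ cliffordT n := by
  rw [← onQubit_eq_multiplexer]; exact gate_mem (.S t)

theorem tee_mem (t : Fin n) : multiplexer t (fun _ => tee) ∈ cliffordT n := by
  rw [← onQubit_eq_multiplexer]; exact gate_mem (.T t)

theorem omega_pow_smul_one_mem (k : ℕ) :
    omega ^ k • (1 : Matrix (Basis n) (Basis n) ℂ) ∈ cliffordT n := by
  have := pow_mem (gate_mem (n := n) .scalar) k
  rwa [Gate.toMatrix, smul_pow, one_pow] at this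

theorem pauliX_eq : pauliX = hadamard * phase * phase * hadamard := by
  have h0 := sqrt_two_ne_zero
  have h2 := sqrt_two_sq
  ext i j
  fin_cases i <;> fin_cases j <;> simp [hadamard, phase, pauliX] <;> field_simp <;>
    rw [h2] <;> norm_num

theorem pauliX_mem (t : Fin n) : multiplexer t (fun _ => pauliX) ∈ cliffordT n := by
  have := mul_mem (mul_mem (mul_mem (hadamard_mem t) (phase_mem t)) (phase_mem t)) (hadamard_mem t)
  rw [← map_mul, ← map_mul, ← map_mul] at this
  rw [pauliX_eq]
  exact this

/-- Controlled `X` with either control value. -/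
theorem controlled_pauliX_mem (t : Fin n) (c : {j // j ≠ t}) (b : Fin 2) :
    multiplexer t (fun r => if r c = b then pauliX else 1) ∈ cliffordT n := by
  have h1 := gate_mem (.CNOT c.1 t c.2)
  rw [Gate.toMatrix, cnot_eq_multiplexer c.2] at h1
  fin_cases b
  · have := mul_mem h1 (pauliX_mem t)
    rw [← map_mul] at this
    convert this using 2
    ext1 r
    simp only [Pi.mul_apply]
    rcases Fin.exists_fin_two.1 ⟨r c, rfl⟩ with h | h <;> simp [h, pauliX_mul_self]
  · exact h1

theorem tee_commutator_pauliX : tee * pauliX * star tee * pauliX = !![star omega, 0; 0, omega] := by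
  simp only [tee_eq, pauliX, mul_fin_two, star_of_fin_two]
  simp

/-- In the commutator of `T` and `X` only `X` needs a control: when `X` is switched off, `T` and its
inverse cancel. -/
theorem controlled_phase_mem (t : Fin n) (c : {j // j ≠ t}) (b : Fin 2) :
    multiplexer t (fun r => if r c = b then !![star omega, 0; 0, omega] else 1) ∈ cliffordT n := by
  have h1 := tee_mem t
  have h2 := controlled_pauliX_mem t c b
  have := mul_mem (mul_mem (mul_mem h1 h2) (star_mem_cliffordT h1)) h2
  rw [star_multiplexer, ← map_mul, ← map_mul, ← map_mul] at this
  convert this using 2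
  ext1 r
  simp only [Pi.mul_apply, Pi.star_apply]
  split_ifs
  · rw [tee_commutator_pauliX]
  · rw [mul_one, mul_one, mul_eq_one_comm.1 star_tee_mul]

theorem phase_mul_star : !![star omega, 0; 0, omega] * star !![star omega, 0; 0, omega] = 1 := by
  have h := star_omega_mul
  have h' : omega * star omega = 1 := by rw [mul_comm, h]
  rw [star_of_fin_two, mul_fin_two, one_fin_two]
  simp only [star_star, star_zero, mul_zero, zero_mul, add_zero, zero_add, h, h']

/-- The engine of the induction on controls: the commutator of `diag(ω⁻¹, ω)` with `i X` is
`diag(-i, i)`, which `H` conjugates to `-i X`, whose adjoint is `i X` again. -/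
theorem I_pauliX_eq_commutator : star (hadamard * (!![star omega, 0; 0, omega] * (I • pauliX) *
    star !![star omega, 0; 0, omega] * star (I • pauliX)) * hadamard) = I • pauliX := by
  have h0 := sqrt_two_ne_zero
  have h2 := sqrt_two_sq
  have h3 : star omega * star omega = -I := by
    rw [star_omega, ← omega_sq]
    linear_combination omega ^ 6 * omega_pow_eight + omega ^ 2 * omega_pow_four
  have h4 : omega * omega = I := by rw [← omega_sq]; ring
  have h5 : !![star omega, 0; 0, omega] * (I • pauliX) *
      star !![star omega, 0; 0, omega] * star (I • pauliX) = !![-I, 0; 0, I] := by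
    have hX : I • pauliX = !![0, I; I, 0] := by
      ext i j; fin_cases i <;> fin_cases j <;> simp [pauliX]
    have hI : star I = -I := conj_I
    rw [hX, star_of_fin_two, star_of_fin_two, mul_fin_two, mul_fin_two, mul_fin_two]
    simp only [star_star, star_zero, mul_zero, zero_mul, add_zero, zero_add, hI]
    have e1 : star omega * I * star omega * -I = -I := by
      linear_combination (-I ^ 2) * h3 + I * I_sq
    have e2 : omega * I * omega * -I = I := by
      linear_combination (-I ^ 2) * h4 - I * I_sq
    rw [e1, e2]
  rw [h5]
  have hH : hadamard = !![1 / (Real.sqrt 2 : ℂ), 1 / (Real.sqrt 2 : ℂ);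
      1 / (Real.sqrt 2 : ℂ), -(1 / (Real.sqrt 2 : ℂ))] := by
    ext i j; fin_cases i <;> fin_cases j <;> simp [hadamard]
  rw [star_mul, star_mul, star_hadamard, star_of_fin_two, hH, mul_fin_two, mul_fin_two, pauliX]
  ext i j
  fin_cases i <;> fin_cases j <;> simp <;> field_simp <;> rw [h2] <;> ring

theorem star_I_pauliX_mul : star (I • pauliX) * (I • pauliX) = 1 := by
  rw [star_smul, smul_mul_smul_comm, star_pauliX, pauliX_mul_self]
  simp

/-- `i X` with any set of controls, at any control values. -/
theorem multicontrolled_I_pauliX_mem (t : Fin n) (s : Rest t) (C : Finset {j // j ≠ t}) :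
    multiplexer t (fun r => if ∀ c ∈ C, r c = s c then I • pauliX else 1) ∈ cliffordT n := by
  induction C using Finset.induction_on with
  | empty =>
    have := mul_mem (omega_pow_smul_one_mem (n := n) 2) (pauliX_mem t)
    rw [omega_sq, smul_mul_assoc, one_mul] at this
    convert this using 1
    ext x y
    simp [multiplexer_apply]
  | insert c C hc ih =>
    -- The phase is controlled by the new qubit and `i X` by the old ones. The commutator is trivial
    -- unless both fire, and the outer Hadamards then cancel.
    have h1 := controlled_phase_mem t c (s c)
    have hH := hadamard_mem t
    have := star_mem_cliffordT (mul_mem (mul_mem hH (mul_mem (mul_mem (mul_mem h1 ih)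
      (star_mem_cliffordT h1)) (star_mem_cliffordT ih))) hH)
    rw [star_multiplexer, star_multiplexer, ← map_mul, ← map_mul, ← map_mul, ← map_mul, ← map_mul,
      star_multiplexer] at this
    convert this using 2
    ext1 r
    simp only [Pi.mul_apply, Pi.star_apply, Finset.forall_mem_insert]
    by_cases hc : r c = s c <;> by_cases hC : ∀ c ∈ C, r c = s c
    · rw [if_pos ⟨hc, hC⟩, if_pos hc, if_pos hC, I_pauliX_eq_commutator]
    · rw [if_neg fun h => hC h.2, if_pos hc, if_neg hC, mul_one, star_one, mul_one, phase_mul_star, mul_one,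
        hadamard_mul_self, star_one]
    · rw [if_neg fun h => hc h.1, if_neg hc, if_pos hC, one_mul, star_one, mul_one,
        mul_eq_one_comm.1 star_I_pauliX_mul, mul_one, hadamard_mul_self, star_one]
    · rw [if_neg fun h => hc h.1, if_neg hc, if_neg hC, star_one, mul_one, mul_one, mul_one, mul_one,
        hadamard_mul_self, star_one]

/-! ### Fully controlled one-qubit operators of determinant one. -/

/-- The elements of the ancilla-free Clifford+T group of determinant `1`. -/
def specialCliffordT (n : ℕ) : Submonoid (Matrix (Basis n) (Basis n) ℂ) :=
  cliffordT n ⊓ MonoidHom.mker detMonoidHom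

theorem mem_specialCliffordT {M : Matrix (Basis n) (Basis n) ℂ} :
    M ∈ specialCliffordT n ↔ M ∈ cliffordT n ∧ M.det = 1 := Iff.rfl

/-- `A`, applied to any qubit and controlled by any pattern of all the other qubits, is in the
ancilla-free Clifford+T group. -/
def FullyControllable (n : ℕ) (A : Matrix (Fin 2) (Fin 2) ℂ) : Prop :=
  A.det = 1 ∧ ∀ (t : Fin n) (s : Rest t),
    multiplexer t (fun r => if r = s then A else 1) ∈ cliffordT n

theorem fullyControllable_I_pauliX : FullyControllable n (I • pauliX) := by
  refine ⟨by simp [pauliX, det_fin_two], fun t s => ?_⟩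
  simpa [funext_iff] using multicontrolled_I_pauliX_mem t s Finset.univ

/-- The conjugator needs no controls, since `V * star V = 1` on every other block. -/
theorem FullyControllable.conj {A V : Matrix (Fin 2) (Fin 2) ℂ} (hA : FullyControllable n A)
    (hV : ∀ t : Fin n, multiplexer t (fun _ => V) ∈ cliffordT n) (hVV : V * star V = 1) :
    FullyControllable n (V * A * star V) := by
  refine ⟨?_, fun t s => ?_⟩
  · rw [det_mul, det_mul, hA.1, mul_one, ← det_mul, hVV, det_one]
  · have := mul_mem (mul_mem (hV t) (hA.2 t s)) (star_mem_cliffordT (hV t))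
    rw [star_multiplexer, ← map_mul, ← map_mul] at this
    convert this using 2
    ext1 r
    simp only [Pi.mul_apply, Pi.star_apply]
    split_ifs
    · rfl
    · rw [mul_one, hVV]

theorem tee_pow (k : ℕ) : tee ^ k = !![1, 0; 0, omega ^ k] := by
  have h (a b : ℂ) : !![a, 0; 0, b] = diagonal ![a, b] := by
    ext i j; fin_cases i <;> fin_cases j <;> simp
  rw [tee_eq, h, h, diagonal_pow]
  congr 1
  ext i
  fin_cases i <;> simp

theorem FullyControllable.tee_pow_conj {A : Matrix (Fin 2) (Fin 2) ℂ}
    (hA : FullyControllable n A) (k : ℕ) : FullyControllable n (tee ^ k * A * star (tee ^ k)) := by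
  refine hA.conj (fun t => ?_) ?_
  · have := pow_mem (tee_mem t) k
    rwa [← map_pow] at this
  · have h1 := mul_eq_one_comm.1 star_tee_mul
    have h2 : Commute tee (star tee) := h1.trans star_tee_mul.symm
    rw [star_pow, ← h2.mul_pow, h1, one_pow]

theorem fullyControllable_antidiagonal (k : ℕ) :
    FullyControllable n !![0, I * star omega ^ k; I * omega ^ k, 0] := by
  convert fullyControllable_I_pauliX.tee_pow_conj k using 1
  have hX : I • pauliX = !![0, I; I, 0] := by
    ext i j; fin_cases i <;> fin_cases j <;> simp [pauliX]
  rw [tee_pow, hX, star_of_fin_two, mul_fin_two, mul_fin_two]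
  simp [mul_comm]

/-- On the Bloch sphere, `T` takes `X` to `(X + Y)/√2`, then `H` takes it to `(Z - Y)/√2`, and `S`
takes that to `(Z + X)/√2`, which is the matrix `H`. The last conjugation by `H` changes nothing. -/
theorem I_hadamard_eq_conj : hadamard * phase * hadamard * tee * (I • pauliX) *
    star (hadamard * phase * hadamard * tee) = I • hadamard := by
  have h0 := sqrt_two_ne_zero
  have h2 := sqrt_two_sq
  have hX : tee * (I • pauliX) * star tee = !![0, I * star omega; I * omega, 0] := by
    have hX : I • pauliX = !![0, I; I, 0] := by
      ext i j; fin_cases i <;> fin_cases j <;> simp [pauliX]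
    rw [tee_eq, hX, star_of_fin_two, mul_fin_two, mul_fin_two]
    simp [mul_comm]
  have hH : hadamard = !![1 / (Real.sqrt 2 : ℂ), 1 / (Real.sqrt 2 : ℂ);
      1 / (Real.sqrt 2 : ℂ), -(1 / (Real.sqrt 2 : ℂ))] := by
    ext i j; fin_cases i <;> fin_cases j <;> simp [hadamard]
  have h1 : star omega = (1 / (Real.sqrt 2 : ℂ)) * (1 - I) := by
    rw [omega_eq]
    simp [sub_eq_add_neg]
  have hsI : star I = -I := conj_I
  have hstep : hadamard * !![0, I * star omega; I * omega, 0] * hadamard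
      = !![I / (Real.sqrt 2 : ℂ), I * I / (Real.sqrt 2 : ℂ);
        -(I * I) / (Real.sqrt 2 : ℂ), -I / (Real.sqrt 2 : ℂ)] := by
    rw [hH, mul_fin_two, mul_fin_two, h1, omega_eq]
    ext i j
    fin_cases i <;> fin_cases j <;> simp <;> field_simp <;> rw [h2] <;> ring_nf <;>
      norm_num [I_sq]
  have hstep2 : phase * !![I / (Real.sqrt 2 : ℂ), I * I / (Real.sqrt 2 : ℂ);
        -(I * I) / (Real.sqrt 2 : ℂ), -I / (Real.sqrt 2 : ℂ)] * star phase = I • hadamard := by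
    rw [hH, phase, star_of_fin_two, mul_fin_two, mul_fin_two, hsI]
    ext i j
    fin_cases i <;> fin_cases j <;> simp <;> field_simp <;> simp
  have hstep3 : hadamard * (I • hadamard) * hadamard = I • hadamard := by
    rw [mul_smul_comm, hadamard_mul_self, smul_mul_assoc, one_mul]
  calc _ = hadamard * (phase * (hadamard * (tee * (I • pauliX) * star tee) * hadamard) * star phase)
        * hadamard := by simp only [star_mul, star_hadamard, mul_assoc]
    _ = _ := by rw [hX, hstep, hstep2, hstep3]

theorem fullyControllable_hadamard (k : ℕ) :
    FullyControllable n ((I / (Real.sqrt 2 : ℂ)) • !![1, star omega ^ k; omega ^ k, -1]) := by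
  have h1 : FullyControllable n (I • hadamard) := by
    rw [← I_hadamard_eq_conj]
    refine fullyControllable_I_pauliX.conj (fun t => ?_) ?_
    · have := mul_mem (mul_mem (mul_mem (hadamard_mem t) (phase_mem t)) (hadamard_mem t)) (tee_mem t)
      rw [← map_mul, ← map_mul, ← map_mul] at this
      exact this
    · rw [mul_eq_one_comm]
      calc _ = star tee * (hadamard * (star phase * (hadamard * hadamard) * phase) * hadamard)
            * tee := by simp only [star_mul, star_hadamard, mul_assoc]
        _ = 1 := by
          rw [hadamard_mul_self, mul_one, star_phase_mul, mul_one, hadamard_mul_self, mul_one,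
            star_tee_mul]
  convert h1.tee_pow_conj k using 1
  have h := star_omega_pow_mul k
  rw [tee_pow, hadamard, star_of_fin_two, smul_smul, mul_smul_comm, smul_mul_assoc, mul_fin_two,
    mul_fin_two, mul_one_div]
  simp [mul_comm, ← mul_pow, show omega * (starRingEnd ℂ) omega = 1 by
    rw [mul_comm]; exact star_omega_mul]

/-! ### Two-level operators on arbitrary pairs of basis states. -/

/-- The result of applying `A` to the entries of a vector at `x` and `y`. -/
def twoLevelAct {ι : Type*} [DecidableEq ι] (A : Matrix (Fin 2) (Fin 2) ℂ) (x y : ι) (v : ι → ℂ) :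
    ι → ℂ :=
  Function.update (Function.update v x (A 0 0 * v x + A 0 1 * v y)) y (A 1 0 * v x + A 1 1 * v y)

theorem multiplexer_mulVec (t : Fin n) (f : Rest t → Matrix (Fin 2) (Fin 2) ℂ) (v : Basis n → ℂ)
    (x : Basis n) : (multiplexer t f *ᵥ v) x =
      ∑ b, f (fun j => x j) (x t) b * v (Function.update x t b) := by
  have hupd (b : Fin 2) :
      (Equiv.funSplitAt t (Fin 2)).symm (b, fun j => x j) = Function.update x t b := by
    rw [Equiv.symm_apply_eq]
    ext1
    · simp [Equiv.funSplitAt, Equiv.piSplitAt]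
    · ext j
      simp [Equiv.funSplitAt, Equiv.piSplitAt, j.2]
  rw [mulVec, dotProduct, ← (Equiv.funSplitAt t (Fin 2)).symm.sum_comp, Fintype.sum_prod_type]
  refine Finset.sum_congr rfl fun b _ => ?_
  refine (Finset.sum_eq_single (fun j => x j : Rest t) ?_ ?_).trans ?_
  rotate_left 2
  · rw [hupd, multiplexer_apply, if_pos (by ext j; simp [j.2]), Function.update_self]
  · intro r _ hr
    rw [multiplexer_apply, if_neg, zero_mul]
    intro h
    apply hr
    rw [h]
    ext j
    simp [Equiv.funSplitAt, Equiv.piSplitAt, j.2]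
  · simp

/-- The two-level operator given by `A` at `x` and `y` is in the Clifford+T group. -/
def HasTwoLevel (A : Matrix (Fin 2) (Fin 2) ℂ) (x y : Basis n) : Prop :=
  ∃ M ∈ specialCliffordT n, ∀ v, M *ᵥ v = twoLevelAct A x y v

theorem FullyControllable.hasTwoLevel_of_bits {A : Matrix (Fin 2) (Fin 2) ℂ}
    (hA : FullyControllable n A) {x y : Basis n} {t : Fin n} (hx : x t = 0) (hy : y t = 1)
    (h : ∀ j, j ≠ t → x j = y j) : HasTwoLevel A x y := by
  have hr : (fun j : {j // j ≠ t} => x j) = fun j : {j // j ≠ t} => y j :=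
    funext fun j => h j j.2
  have hxu (z : Basis n) (hz : (fun j : {j // j ≠ t} => z j) = fun j : {j // j ≠ t} => x j) :
      Function.update z t 0 = x ∧ Function.update z t 1 = y := by
    constructor <;> ext j <;> by_cases hj : j = t
    · subst hj; simp [hx]
    · simp [hj, congrFun hz ⟨j, hj⟩]
    · subst hj; simp [hy]
    · simp [hj, congrFun hz ⟨j, hj⟩, h j hj]
  refine ⟨_, mem_specialCliffordT.2 ⟨hA.2 t fun j => x j, ?_⟩, fun v => ?_⟩
  · rw [det_multiplexer]
    refine Finset.prod_eq_one fun r _ => ?_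
    split_ifs
    · exact hA.1
    · exact det_one
  · ext z
    rw [multiplexer_mulVec, Fin.sum_univ_two, twoLevelAct]
    by_cases hz : (fun j : {j // j ≠ t} => z j) = fun j : {j // j ≠ t} => x j
    · obtain ⟨h0, h1⟩ := hxu z hz
      rw [if_pos hz, h0, h1]
      rcases Fin.exists_fin_two.1 ⟨z t, rfl⟩ with hzt | hzt
      · have : z = x := by rw [← h0, ← hzt, Function.update_eq_self]
        subst this
        rw [Function.update_of_ne, Function.update_self, hx]
        rintro rfl
        rw [hx] at hy
        exact absurd hy (by decide)
      · have : z = y := by rw [← h1, ← hzt, Function.update_eq_self]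
        subst this
        rw [Function.update_self, hy]
    · have hzx : z ≠ x := by rintro rfl; exact hz rfl
      have hzy : z ≠ y := by rintro rfl; exact hz hr.symm
      rw [if_neg hz, Function.update_of_ne hzy, Function.update_of_ne hzx]
      rcases Fin.exists_fin_two.1 ⟨z t, rfl⟩ with hzt | hzt
      · have : Function.update z t 0 = z := by rw [← hzt, Function.update_eq_self]
        simp [hzt, this, one_apply]
      · have : Function.update z t 1 = z := by rw [← hzt, Function.update_eq_self]
        simp [hzt, this, one_apply]

/-- Conjugation by a permutation relabels the two positions. `P` may have determinant `-1`, but it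
occurs twice and `P * P = 1`. -/
theorem HasTwoLevel.of_involution {A : Matrix (Fin 2) (Fin 2) ℂ} {x y : Basis n}
    {P : Matrix (Basis n) (Basis n) ℂ} (hP : P ∈ cliffordT n) {σ : Basis n → Basis n}
    (hσ : Function.Involutive σ) (hPσ : ∀ v, P *ᵥ v = v ∘ σ) (h : HasTwoLevel A (σ x) (σ y)) :
    HasTwoLevel A x y := by
  obtain ⟨M, hM, hMv⟩ := h
  rw [mem_specialCliffordT] at hM
  have hPP : P * P = 1 := by
    refine ext_of_mulVec_single fun i => ?_
    rw [← mulVec_mulVec, hPσ, hPσ, Function.comp_assoc, hσ.comp_self, one_mulVec, Function.comp_id]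
  refine ⟨P * M * P, mem_specialCliffordT.2 ⟨mul_mem (mul_mem hP hM.1) hP, ?_⟩, fun v => ?_⟩
  · rw [det_mul, det_mul, hM.2, mul_one, ← det_mul, hPP, det_one]
  · rw [← mulVec_mulVec, ← mulVec_mulVec, hPσ, hPσ, hMv]
    ext z
    simp only [twoLevelAct, Function.comp_apply, Function.update_apply, hσ _, hσ.injective.eq_iff]

theorem pauliX_mulVec (t : Fin n) (v : Basis n → ℂ) :
    multiplexer t (fun _ => pauliX) *ᵥ v = v ∘ fun x => Function.update x t (x t + 1) := by
  ext x
  rw [multiplexer_mulVec, Fin.sum_univ_two, Function.comp_apply]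
  rcases Fin.exists_fin_two.1 ⟨x t, rfl⟩ with h | h <;> simp [h, pauliX]

theorem cnot_mulVec {c t : Fin n} (h : c ≠ t) (v : Basis n → ℂ) :
    cnot c t *ᵥ v = v ∘ fun x => Function.update x t (x t + x c) := by
  ext x
  rw [cnot_eq_multiplexer h, multiplexer_mulVec, Fin.sum_univ_two, Function.comp_apply]
  rcases Fin.exists_fin_two.1 ⟨x t, rfl⟩ with h | h <;>
    rcases Fin.exists_fin_two.1 ⟨x c, rfl⟩ with h' | h' <;> simp [h, h', pauliX, one_apply]

theorem involutive_flip (t : Fin n) :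
    Function.Involutive fun x : Basis n => Function.update x t (x t + 1) := by
  intro x
  have : x t + 1 + 1 = x t := by generalize x t = a; decide +revert
  simp [this]

theorem involutive_cnot {c t : Fin n} (h : c ≠ t) :
    Function.Involutive fun x : Basis n => Function.update x t (x t + x c) := by
  intro x
  have : x t + x c + x c = x t := by generalize x t = a; generalize x c = b; decide +revert
  simp [h, this]

theorem FullyControllable.hasTwoLevel_of_adjacent {A : Matrix (Fin 2) (Fin 2) ℂ}
    (hA : FullyControllable n A) {x y : Basis n} {t : Fin n} (hxy : x t ≠ y t)
    (h : ∀ j, j ≠ t → x j = y j) : HasTwoLevel A x y := by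
  rcases Fin.exists_fin_two.1 ⟨x t, rfl⟩ with hx | hx
  · refine hA.hasTwoLevel_of_bits hx ?_ h
    generalize y t = b at *
    rw [hx] at hxy
    omega
  · refine HasTwoLevel.of_involution (pauliX_mem t) (involutive_flip t) (pauliX_mulVec t)
      (hA.hasTwoLevel_of_bits (t := t) ?_ ?_ ?_)
    · simp [hx]
    · simp only [Function.update_self]
      generalize y t = b at *
      rw [hx] at hxy
      revert hxy
      decide +revert
    · intro j hj
      simp [hj, h j hj]

/-- Fix a bit `c` where the strings differ. For any other differing bit `t`, a CNOT from `c` to `t`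
flips `t` in exactly one of them, so the differences outside `c` are removed one by one. -/
theorem FullyControllable.hasTwoLevel {A : Matrix (Fin 2) (Fin 2) ℂ}
    (hA : FullyControllable n A) {x y : Basis n} (hxy : x ≠ y) : HasTwoLevel A x y := by
  obtain ⟨c, hc⟩ := Function.ne_iff.1 hxy
  suffices H : ∀ (s : Finset (Fin n)) (x y : Basis n), x c ≠ y c → c ∉ s →
      (∀ j, j ≠ c → j ∉ s → x j = y j) → HasTwoLevel A x y from
    H (Finset.univ.erase c) x y hc (by simp) (by simp +contextual)
  intro s
  induction s using Finset.induction_on with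
  | empty =>
    intro x y hc _ h
    exact hA.hasTwoLevel_of_adjacent hc fun j hj => h j hj (Finset.notMem_empty j)
  | insert t s ht ih =>
    intro x y hc hcs h
    have hct : c ≠ t := fun e => hcs (e ▸ Finset.mem_insert_self t s)
    have hcs' : c ∉ s := fun e => hcs (Finset.mem_insert_of_mem e)
    by_cases hxy : x t = y t
    · refine ih x y hc hcs' fun j hj hjs => ?_
      by_cases hjt : j = t
      · rw [hjt, hxy]
      · exact h j hj (by simp [hjt, hjs])
    · refine HasTwoLevel.of_involution (gate_mem (.CNOT c t hct)) (involutive_cnot hct)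
        (cnot_mulVec hct) (ih _ _ ?_ hcs' fun j hj hjs => ?_)
      · simpa [hct] using hc
      · by_cases hjt : j = t
        · subst hjt
          simp only [Function.update_self]
          generalize x j = a at *
          generalize y j = b at *
          generalize x c = d at *
          generalize y c = e at *
          clear * - hxy hc
          decide +revert
        · simpa [hjt] using h j hj (by simp [hjt, hjs])

/-! ### Integrality of entries and column reduction. -/

theorem cliffordT_apply_mem_ringZ {M : Matrix (Basis n) (Basis n) ℂ} (hM : M ∈ cliffordT n)
    (x y : Basis n) : M x y ∈ ringZ := by
  have hmult {t : Fin n} {f : Rest t → Matrix (Fin 2) (Fin 2) ℂ}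
      (h : ∀ r a b, f r a b ∈ ringZ) (x y : Basis n) : multiplexer t f x y ∈ ringZ := by
    rw [multiplexer_apply]
    split_ifs
    · exact h _ _ _
    · exact zero_mem _
  have h1 : (1 : ℂ) ∈ ringZ := one_mem _
  have h0 : (0 : ℂ) ∈ ringZ := zero_mem _
  have hs := inv_sqrt_two_mem_ringZ
  have hω := omega_mem_ringZ
  have hI := I_mem_ringZ
  induction hM using Submonoid.closure_induction generalizing x y with
  | mem M h =>
    obtain ⟨g, rfl⟩ := h
    cases g with
    | scalar =>
      rw [Gate.toMatrix, Matrix.smul_apply, one_apply, smul_eq_mul]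
      split_ifs
      · exact mul_mem hω h1
      · exact mul_mem hω h0
    | H k =>
      rw [Gate.toMatrix, onQubit_eq_multiplexer]
      refine hmult (fun r a b => ?_) x y
      rw [one_div] at hs
      fin_cases a <;> fin_cases b <;> simp [hadamard, hs]
    | S k =>
      rw [Gate.toMatrix, onQubit_eq_multiplexer]
      refine hmult (fun r a b => ?_) x y
      fin_cases a <;> fin_cases b <;> simp [phase, hI]
    | T k =>
      rw [Gate.toMatrix, onQubit_eq_multiplexer]
      refine hmult (fun r a b => ?_) x y
      fin_cases a <;> fin_cases b <;> simp [tee_eq, hω]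
    | CNOT c t h =>
      rw [Gate.toMatrix, cnot, of_apply]
      split_ifs <;> assumption
  | one =>
    rw [one_apply]
    split_ifs <;> assumption
  | mul M N _ _ hM hN =>
    rw [mul_apply]
    exact sum_mem fun z _ => mul_mem (hM x z) (hN z y)

/-- The elements of determinant `1` of the Clifford+T group that fix all basis vectors outside
`B`. -/
def fixingCliffordT (B : Finset (Basis n)) : Submonoid (Matrix (Basis n) (Basis n) ℂ) where
  carrier := {M | M ∈ specialCliffordT n ∧ ∀ z ∉ B, M *ᵥ Pi.single z 1 = Pi.single z 1}
  one_mem' := ⟨one_mem _, fun z _ => one_mulVec _⟩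
  mul_mem' := fun {M N} hM hN => ⟨mul_mem hM.1 hN.1, fun z hz => by
    rw [← mulVec_mulVec, hN.2 z hz, hM.2 z hz]⟩

/-- For a unitary matrix a fixed basis vector is also fixed by the adjoint, so the row is trivial
along with the column. Hence operations on `B` do not disturb finished coordinates. -/
theorem row_of_fixed {ι : Type*} [Fintype ι] [DecidableEq ι] {M : Matrix ι ι ℂ}
    (hM : star M * M = 1) {z : ι} (hz : M *ᵥ Pi.single z 1 = Pi.single z 1) (w : ι) :
    M z w = if z = w then 1 else 0 := by
  have h : star M *ᵥ Pi.single z 1 = Pi.single z 1 := by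
    nth_rw 1 [← hz]
    rw [mulVec_mulVec, hM, one_mulVec]
  have := congrFun h w
  rw [mulVec_single_one, col_apply, star_apply] at this
  rw [← star_star (M z w), this, Pi.single_apply]
  split_ifs with h1 h2 h2
  · exact star_one ℂ
  · exact absurd h1.symm h2
  · exact absurd h2.symm h1
  · exact star_zero ℂ

theorem mulVec_of_fixed {ι : Type*} [Fintype ι] [DecidableEq ι] {M : Matrix ι ι ℂ}
    (hM : star M * M = 1) {z : ι} (hz : M *ᵥ Pi.single z 1 = Pi.single z 1) (v : ι → ℂ) :
    (M *ᵥ v) z = v z := by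
  simp [mulVec, dotProduct, row_of_fixed hM hz]

theorem sum_star_mul_self_mulVec {ι : Type*} [Fintype ι] [DecidableEq ι] {M : Matrix ι ι ℂ}
    (hM : star M * M = 1) (v : ι → ℂ) :
    ∑ z, star ((M *ᵥ v) z) * (M *ᵥ v) z = ∑ z, star (v z) * v z := by
  have : star (M *ᵥ v) ⬝ᵥ (M *ᵥ v) = star v ⬝ᵥ v := by
    rw [star_mulVec, dotProduct_mulVec, vecMul_vecMul, ← star_eq_conjTranspose, hM, vecMul_one]
  simpa [dotProduct] using this

theorem fixingCliffordT_star_mul_self {B : Finset (Basis n)} {M : Matrix (Basis n) (Basis n) ℂ}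
    (hM : M ∈ fixingCliffordT B) : star M * M = 1 :=
  cliffordT_star_mul_self (mem_specialCliffordT.1 hM.1).1

theorem exists_twoLevel {A : Matrix (Fin 2) (Fin 2) ℂ} (hA : FullyControllable n A)
    {B : Finset (Basis n)} {x y : Basis n} (hxy : x ≠ y) (hx : x ∈ B) (hy : y ∈ B) :
    ∃ M ∈ fixingCliffordT B, ∀ v, M *ᵥ v = twoLevelAct A x y v := by
  obtain ⟨M, hM, hMv⟩ := hA.hasTwoLevel hxy
  refine ⟨M, ⟨hM, fun z hz => ?_⟩, hMv⟩
  have hzx : x ≠ z := by rintro rfl; exact hz hx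
  have hzy : y ≠ z := by rintro rfl; exact hz hy
  rw [hMv, twoLevelAct]
  ext w
  simp only [Pi.single_eq_of_ne hzx, Pi.single_eq_of_ne hzy, mul_zero, add_zero]
  rw [Function.update_apply, Function.update_apply]
  split_ifs with h1 h2
  · rw [h1, Pi.single_eq_of_ne hzy]
  · rw [h2, Pi.single_eq_of_ne hzx]
  · rfl

theorem exists_move {B : Finset (Basis n)} {x y : Basis n} (hxy : x ≠ y) (hx : x ∈ B) (hy : y ∈ B)
    (m : ℕ) : ∃ M ∈ fixingCliffordT B, M *ᵥ Pi.single y (omega ^ m) = Pi.single x 1 := by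
  -- The shift by `2` absorbs the factor `i = ω ^ 2` of the antidiagonal matrix.
  obtain ⟨M, hM, hMv⟩ := exists_twoLevel (fullyControllable_antidiagonal (m + 2)) hxy hx hy
  refine ⟨M, hM, ?_⟩
  have h : I * star omega ^ (m + 2) * omega ^ m = 1 := by
    rw [← star_omega_pow_mul (m + 2), ← omega_sq]
    ring
  rw [hMv, twoLevelAct]
  ext z
  by_cases hzy : z = y
  · subst hzy
    simp [hxy.symm, hxy]
  · by_cases hzx : z = x
    · subst hzx
      simpa [hxy] using h
    · simp [hzx, hzy]

/-- Decreasing the denominator exponent of a unit vector. -/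
theorem exists_decrease_exponent {B : Finset (Basis n)} {k : ℕ} {v : Basis n → ℂ}
    (hB : ∀ z ∉ B, v z = 0) (hv : ∀ z, delta ^ (k + 1) * v z ∈ zomega)
    (hn : ∑ z, star (v z) * v z = 1) :
    ∃ M ∈ fixingCliffordT B, ∀ z, delta ^ k * (M *ᵥ v) z ∈ zomega := by
  classical
  -- Induction on the set of odd numerators; each step removes two of them and creates none.
  generalize hs : Finset.univ.filter (fun z => delta ^ k * v z ∉ zomega) = s
  induction s using Finset.strongInduction generalizing v with
  | H s ih =>
  have hd := delta_ne_zero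
  have hodd (a : ℂ) : delta ^ k * a ∉ zomega ↔ ∀ w ∈ zomega, delta ^ (k + 1) * a ≠ delta * w := by
    constructor
    · intro h w hw e
      refine h ?_
      rwa [mul_left_cancel₀ hd (show delta * (delta ^ k * a) = delta * w by rw [← e]; ring)]
    · intro h e
      exact h _ e (by ring)
  have heven : Even s.card := by
    refine even_card_odd hv (fun z => ?_) ?_
    · rw [← hs, Finset.mem_filter, ← hodd]
      simp
    · refine ⟨star delta ^ (k + 1) * delta ^ k, mul_mem
        (pow_mem (star_mem_zomega delta_mem_zomega) _) (pow_mem delta_mem_zomega _), ?_⟩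
      calc ∑ z, star (delta ^ (k + 1) * v z) * (delta ^ (k + 1) * v z)
          = ∑ z, star delta ^ (k + 1) * delta ^ (k + 1) * (star (v z) * v z) :=
            Finset.sum_congr rfl fun z _ => by rw [star_mul', star_pow]; ring
        _ = _ := by rw [← Finset.mul_sum, hn]; ring
  rcases Nat.eq_zero_or_pos s.card with hcard | hcard
  · refine ⟨1, one_mem _, fun z => ?_⟩
    rw [one_mulVec]
    by_contra hz
    have : z ∈ s := by rw [← hs, Finset.mem_filter]; exact ⟨Finset.mem_univ z, hz⟩
    rw [Finset.card_eq_zero.1 hcard] at this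
    exact Finset.notMem_empty z this
  · have h1 : 1 < s.card := by
      obtain ⟨r, hr⟩ := heven
      omega
    obtain ⟨x, hx, y, hy, hxy⟩ := Finset.one_lt_card.1 h1
    have hsB (z) (hz : z ∈ s) : delta ^ k * v z ∉ zomega ∧ z ∈ B := by
      rw [← hs, Finset.mem_filter] at hz
      refine ⟨hz.2, ?_⟩
      by_contra hzB
      rw [hB z hzB, mul_zero] at hz
      exact hz.2 (zero_mem _)
    obtain ⟨hxo, hxB⟩ := hsB x hx
    obtain ⟨hyo, hyB⟩ := hsB y hy
    obtain ⟨j, ⟨w, hw, hxw⟩, ⟨w', hw', hyw⟩⟩ :=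
      exists_hadamard_even (hv x) (hv y) ((hodd _).1 hxo) ((hodd _).1 hyo)
    obtain ⟨M, hM, hMv⟩ := exists_twoLevel (fullyControllable_hadamard j) hxy hxB hyB
    have hMM := fixingCliffordT_star_mul_self hM
    have hvx : delta ^ k * (M *ᵥ v) x = w := by
      refine mul_left_cancel₀ hd ?_
      rw [← hxw, hMv, twoLevelAct, Function.update_of_ne hxy, Function.update_self]
      simp
      ring
    have hvy : delta ^ k * (M *ᵥ v) y = w' := by
      refine mul_left_cancel₀ hd ?_
      rw [← hyw, hMv, twoLevelAct, Function.update_self]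
      simp
      ring
    have hvz (z) (hzx : z ≠ x) (hzy : z ≠ y) : (M *ᵥ v) z = v z := by
      rw [hMv, twoLevelAct, Function.update_of_ne hzy, Function.update_of_ne hzx]
    have hsub : Finset.univ.filter (fun z => delta ^ k * (M *ᵥ v) z ∉ zomega) ⊂ s := by
      refine (Finset.ssubset_iff_of_subset fun z hz => ?_).2 ⟨x, hx, fun hx' => ?_⟩
      · rw [Finset.mem_filter] at hz
        by_cases hzx : z = x
        · exact hzx ▸ hx
        by_cases hzy : z = y
        · exact hzy ▸ hy
        rw [← hs, Finset.mem_filter, ← hvz z hzx hzy]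
        exact hz
      · rw [Finset.mem_filter, hvx] at hx'
        exact hx'.2 hw
    have hB' : ∀ z ∉ B, (M *ᵥ v) z = 0 := fun z hz => by
      rw [mulVec_of_fixed hMM (hM.2 z hz), hB z hz]
    have hv' : ∀ z, delta ^ (k + 1) * (M *ᵥ v) z ∈ zomega := fun z => by
      rw [pow_succ', mul_assoc]
      by_cases hzx : z = x
      · rw [hzx, hvx]; exact mul_mem delta_mem_zomega hw
      by_cases hzy : z = y
      · rw [hzy, hvy]; exact mul_mem delta_mem_zomega hw'
      rw [hvz z hzx hzy, ← mul_assoc, ← pow_succ']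
      exact hv z
    obtain ⟨N, hN, hNv⟩ := ih _ hsub hB' hv' ((sum_star_mul_self_mulVec hMM v).trans hn) rfl
    exact ⟨N * M, mul_mem hN hM, by rwa [← mulVec_mulVec]⟩

theorem exists_reduce_to_basis {B : Finset (Basis n)} {k : ℕ} {v : Basis n → ℂ}
    (hB : ∀ z ∉ B, v z = 0) (hv : ∀ z, delta ^ k * v z ∈ zomega)
    (hn : ∑ z, star (v z) * v z = 1) :
    ∃ M ∈ fixingCliffordT B, ∃ y, ∃ m : ℕ, M *ᵥ v = Pi.single y (omega ^ m) := by
  induction k generalizing v with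
  | zero =>
    obtain ⟨y, m, h⟩ := unit_vector_zomega (v := v) (by simpa using hv) hn
    exact ⟨1, one_mem _, y, m, by rw [one_mulVec, h]⟩
  | succ k ih =>
    obtain ⟨M, hM, hMv⟩ := exists_decrease_exponent hB hv hn
    have hMM := fixingCliffordT_star_mul_self hM
    obtain ⟨N, hN, y, m, h⟩ := ih
      (fun z hz => by rw [mulVec_of_fixed hMM (hM.2 z hz), hB z hz]) hMv
      ((sum_star_mul_self_mulVec hMM v).trans hn)
    exact ⟨N * M, mul_mem hN hM, y, m, by rw [← mulVec_mulVec, h]⟩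

theorem exists_reduce_to {B : Finset (Basis n)} (hcard : 1 < B.card) {y : Basis n} (hy : y ∈ B)
    {v : Basis n → ℂ} (hB : ∀ z ∉ B, v z = 0) (hv : ∀ z, v z ∈ ringZ)
    (hn : ∑ z, star (v z) * v z = 1) :
    ∃ M ∈ fixingCliffordT B, M *ᵥ v = Pi.single y 1 := by
  obtain ⟨k, hk⟩ := exists_delta_pow_mul_mem_pi hv
  obtain ⟨M, hM, x, m, h⟩ := exists_reduce_to_basis hB hk hn
  have hx : x ∈ B := by
    by_contra hx
    have := mulVec_of_fixed (fixingCliffordT_star_mul_self hM) (hM.2 x hx) v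
    rw [h, Pi.single_eq_same, hB x hx] at this
    exact pow_ne_zero m omega_ne_zero this
  by_cases hyx : y = x
  -- A move needs two distinct positions, so a phase at `y` itself is removed by a detour through
  -- another `z ∈ B`; this is where `1 < B.card` is used.
  · subst hyx
    obtain ⟨z, hz, hzy⟩ := Finset.exists_mem_ne hcard y
    obtain ⟨N, hN, hNv⟩ := exists_move hzy hz hy m
    obtain ⟨N', hN', hNv'⟩ := exists_move hzy.symm hy hz 0
    refine ⟨N' * (N * M), mul_mem hN' (mul_mem hN hM), ?_⟩
    rw [← mulVec_mulVec, ← mulVec_mulVec, h, hNv, ← hNv', pow_zero]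
  · obtain ⟨N, hN, hNv⟩ := exists_move hyx hy hx m
    exact ⟨N * M, mul_mem hN hM, by rw [← mulVec_mulVec, h, hNv]⟩

/-- Such a matrix is diagonal with at most one undetermined entry, which equals the determinant. -/
theorem eq_one_of_fixed {ι : Type*} [Fintype ι] [DecidableEq ι] {U : Matrix ι ι ℂ}
    (hU : star U * U = 1) (hdet : U.det = 1) {B : Finset ι} (hB : B.card ≤ 1)
    (hfix : ∀ z ∉ B, U *ᵥ Pi.single z 1 = Pi.single z 1) : U = 1 := by
  have hcol (z) (hz : z ∉ B) (w : ι) : U w z = if w = z then 1 else 0 := by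
    have := congrFun (hfix z hz) w
    rwa [mulVec_single_one, col_apply, Pi.single_apply] at this
  have hdiag : U = diagonal fun z => U z z := by
    ext z w
    rw [diagonal_apply]
    split_ifs with h
    · rw [h]
    · by_cases hw : w ∈ B
      · have hz : z ∉ B := fun hz => h (Finset.card_le_one.1 hB z hz w hw)
        rw [row_of_fixed hU (hfix z hz), if_neg h]
      · rw [hcol w hw, if_neg h]
  have hone : ∀ z, U z z = 1 := by
    intro z
    by_cases hz : z ∈ B
    · rw [hdiag, det_diagonal, Finset.prod_eq_single z] at hdet
      · exact hdet
      · intro w _ hwz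
        have hw : w ∉ B := fun hw => hwz (Finset.card_le_one.1 hB w hw z hz)
        rw [hcol w hw, if_pos rfl]
      · simp
    · rw [hcol z hz, if_pos rfl]
  rw [hdiag, ← diagonal_one]
  congr 1
  exact funext hone

/-- A special unitary matrix over `ℤ[1/√2, i]` is in the ancilla-free Clifford+T group. -/
theorem special_unitary_mem_cliffordT {U : Matrix (Basis n) (Basis n) ℂ} (hU : star U * U = 1)
    (hR : ∀ x y, U x y ∈ ringZ) (hdet : U.det = 1) : U ∈ cliffordT n := by
  -- `B` holds the basis vectors not yet known to be fixed and loses one with each reduced column.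
  suffices H : ∀ (B : Finset (Basis n)) (U : Matrix (Basis n) (Basis n) ℂ), star U * U = 1 →
      (∀ x y, U x y ∈ ringZ) → U.det = 1 → (∀ z ∉ B, U *ᵥ Pi.single z 1 = Pi.single z 1) →
      U ∈ cliffordT n from H Finset.univ U hU hR hdet (by simp)
  intro B
  induction B using Finset.strongInduction with
  | H B ih =>
  intro U hU hR hdet hfix
  rcases Nat.lt_or_ge 1 B.card with hcard | hcard
  · obtain ⟨y, hy⟩ := Finset.card_pos.1 (zero_lt_one.trans hcard)
    have hcol (z : Basis n) : (U *ᵥ Pi.single y 1) z = U z y := by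
      rw [mulVec_single_one, col_apply]
    obtain ⟨M, hM, hMv⟩ := exists_reduce_to hcard hy (v := U *ᵥ Pi.single y 1)
      (fun z hz => by
        rw [mulVec_of_fixed hU (hfix z hz), Pi.single_eq_of_ne]
        rintro rfl
        exact hz hy)
      (fun z => by rw [hcol]; exact hR z y)
      (by rw [sum_star_mul_self_mulVec hU]; simp [Pi.single_apply])
    have hMM := fixingCliffordT_star_mul_self hM
    obtain ⟨hMG, hMdet⟩ := mem_specialCliffordT.1 hM.1
    have hMU : M * U ∈ cliffordT n := by
      refine ih (B.erase y) (Finset.erase_ssubset hy) (M * U) ?_ (fun x z => ?_) ?_ fun z hz => ?_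
      · rw [star_mul, mul_assoc, ← mul_assoc (star M), hMM, one_mul, hU]
      · rw [mul_apply]
        exact sum_mem fun w _ => mul_mem (cliffordT_apply_mem_ringZ hMG x w) (hR w z)
      · rw [det_mul, hMdet, hdet, one_mul]
      · rw [← mulVec_mulVec]
        by_cases hzy : z = y
        · rw [hzy, hMv]
        · have hzB : z ∉ B := fun h => hz (Finset.mem_erase.2 ⟨hzy, h⟩)
          rw [hfix z hzB, hM.2 z hzB]
    have := mul_mem (star_mem_cliffordT hMG) hMU
    rwa [← mul_assoc, hMM, one_mul] at this
  · rw [eq_one_of_fixed hU hdet hcard hfix]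
    exact one_mem _

theorem unitary_mem_cliffordT {U D : Matrix (Basis n) (Basis n) ℂ} (hU : star U * U = 1)
    (hR : ∀ x y, U x y ∈ ringZ) (hD : D ∈ cliffordT n) (hdet : D.det = U.det) :
    U ∈ cliffordT n := by
  have hDD := cliffordT_mul_star_self hD
  have hD' := star_mem_cliffordT hD
  have h : star D * U ∈ cliffordT n := by
    refine special_unitary_mem_cliffordT ?_ (fun x y => ?_) ?_
    · rw [star_mul, star_star, mul_assoc, ← mul_assoc D, hDD, one_mul, hU]
    · rw [mul_apply]
      exact sum_mem fun w _ => mul_mem (cliffordT_apply_mem_ringZ hD' x w) (hR w y)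
    · rw [det_mul, ← hdet, ← det_mul, cliffordT_star_mul_self hD, det_one]
  have := mul_mem hD h
  rwa [← mul_assoc, hDD, one_mul] at this

/-! ### Determinants -/

theorem card_rest (t : Fin n) : Fintype.card (Rest t) = 2 ^ (n - 1) := by
  simp

theorem det_onQubit (A : Matrix (Fin 2) (Fin 2) ℂ) (t : Fin n) :
    (onQubit A t).det = A.det ^ 2 ^ (n - 1) := by
  rw [onQubit_eq_multiplexer, det_multiplexer, Finset.prod_const, Finset.card_univ, card_rest]

theorem det_tee : tee.det = omega := by simp [tee_eq, det_fin_two]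

/-- `X` occupies the blocks with control bit `1`, half of the `2 ^ (n - 1)` blocks. -/
theorem det_cnot {c t : Fin n} (h : c ≠ t) : (cnot c t).det = (-1) ^ 2 ^ (n - 2) := by
  rw [cnot_eq_multiplexer h, det_multiplexer,
    ← (Equiv.funSplitAt (⟨c, h⟩ : {j // j ≠ t}) (Fin 2)).symm.prod_comp, Fintype.prod_prod_type,
    Fin.prod_univ_two]
  have hc : Fintype.card ({j : {j : Fin n // j ≠ t} // j ≠ ⟨c, h⟩} → Fin 2) = 2 ^ (n - 2) := by
    rw [Fintype.card_fun, Fintype.card_fin]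
    simp [Fintype.card_subtype_compl]
    omega
  simp [Equiv.funSplitAt, Equiv.piSplitAt, pauliX, det_fin_two, Finset.prod_const,
    Finset.card_univ, hc]

theorem det_gate (g : Gate n) : ∃ k, g.toMatrix.det = omega ^ (k * 2 ^ (n - 1)) := by
  have h4 := omega_pow_four
  cases g with
  | scalar =>
    rw [Gate.toMatrix, det_smul, det_one, mul_one]
    -- The determinant is `ω ^ 2 ^ n`, which is `ω ^ (2 * 2 ^ (n - 1))` for positive `n`; for `n =
    -- 0` the truncated `n - 1` is `0` and it is `ω` itself.
    rcases n with _ | n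
    · exact ⟨1, by simp⟩
    · exact ⟨2, by simp [pow_succ, mul_comm]⟩
  | H k =>
    refine ⟨4, ?_⟩
    have : hadamard.det = omega ^ 4 := by
      have h0 := sqrt_two_ne_zero
      rw [h4, hadamard, det_smul, det_fin_two]
      simp [sqrt_two_sq]
      norm_num
    rw [Gate.toMatrix, det_onQubit, this, ← pow_mul]
  | S k =>
    refine ⟨2, ?_⟩
    have : phase.det = omega ^ 2 := by simp [phase, det_fin_two, omega_sq]
    rw [Gate.toMatrix, det_onQubit, this, ← pow_mul]
  | T k => exact ⟨1, by rw [Gate.toMatrix, det_onQubit, det_tee, one_mul]⟩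
  | CNOT c t h =>
    refine ⟨2, ?_⟩
    obtain ⟨m, rfl⟩ : ∃ m, n = m + 2 := ⟨n - 2, by
      have := c.2; have := t.2; have := Fin.val_ne_of_ne h; omega⟩
    rw [Gate.toMatrix, det_cnot, ← h4, ← pow_mul]
    · congr 1
      simp [pow_succ]
      ring
    · exact h

theorem det_cliffordT {M : Matrix (Basis n) (Basis n) ℂ} (hM : M ∈ cliffordT n) :
    ∃ k, M.det = omega ^ (k * 2 ^ (n - 1)) := by
  induction hM using Submonoid.closure_induction with
  | mem M h =>
    obtain ⟨g, rfl⟩ := h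
    exact det_gate g
  | one => exact ⟨0, by simp⟩
  | mul M N _ _ hM hN =>
    obtain ⟨k, hk⟩ := hM
    obtain ⟨l, hl⟩ := hN
    exact ⟨k + l, by rw [det_mul, hk, hl, ← pow_add, add_mul]⟩

theorem exists_mem_cliffordT_det_eq (n k : ℕ) :
    ∃ D ∈ cliffordT n, D.det = omega ^ (k * 2 ^ (n - 1)) := by
  rcases n with _ | n
  · exact ⟨_, omega_pow_smul_one_mem k, by simp⟩
  · refine ⟨onQubit tee 0 ^ k, pow_mem (gate_mem (.T 0)) k, ?_⟩
    rw [det_pow, det_onQubit, det_tee, ← pow_mul, mul_comm]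

theorem omega_pow_mod_eight (k : ℕ) : omega ^ k = omega ^ (k % 8) := by
  conv_lhs => rw [← Nat.div_add_mod k 8, pow_add, pow_mul, omega_pow_eight, one_pow, one_mul]

/-- `ω ^ 2 ^ (n - 1)` has order `8`, `4`, `2`, `1` for `n ≤ 1`, `n = 2`, `n = 3`, `n ≥ 4`. -/
theorem det_condition_iff (n : ℕ) (d : ℂ) :
    ((4 ≤ n → d = 1) ∧ (n = 3 → d ∈ ({-1, 1} : Set ℂ)) ∧
      (n = 2 → d ∈ ({I, -1, -I, 1} : Set ℂ)) ∧
      (n ≤ 1 → d ∈ ({omega, I, omega ^ 3, -1, omega ^ 5, -I, omega ^ 7, 1} : Set ℂ))) ↔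
    ∃ k, d = omega ^ (k * 2 ^ (n - 1)) := by
  have h2 := omega_sq
  have h4 := omega_pow_four
  have h6 : omega ^ 6 = -I := by linear_combination omega ^ 2 * h4 - h2
  rcases (by omega : n ≤ 1 ∨ n = 2 ∨ n = 3 ∨ 4 ≤ n) with hn | rfl | rfl | hn
  · have hn1 : n - 1 = 0 := by omega
    simp only [hn1, pow_zero, mul_one, hn, show ¬ 4 ≤ n by omega, show n ≠ 3 by omega,
      show n ≠ 2 by omega, false_imp_iff, true_and, true_imp_iff, Set.mem_insert_iff,
      Set.mem_singleton_iff]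
    constructor
    · rintro (h | h | h | h | h | h | h | h)
      exacts [⟨1, by rw [h, pow_one]⟩, ⟨2, by rw [h, h2]⟩, ⟨3, h⟩, ⟨4, by rw [h, h4]⟩, ⟨5, h⟩,
        ⟨6, by rw [h, h6]⟩, ⟨7, h⟩, ⟨0, by rw [h, pow_zero]⟩]
    · rintro ⟨k, rfl⟩
      rw [omega_pow_mod_eight k]
      have := Nat.mod_lt k (show 0 < 8 by norm_num)
      interval_cases k % 8 <;> simp [h2, h4, h6]
  · simp only [Set.mem_insert_iff, Set.mem_singleton_iff]
    norm_num
    constructor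
    · rintro (h | h | h | h)
      exacts [⟨1, by rw [h, one_mul, h2]⟩, ⟨2, by rw [h, h4]⟩, ⟨3, by rw [h, h6]⟩,
        ⟨0, by rw [h, zero_mul, pow_zero]⟩]
    · rintro ⟨k, rfl⟩
      rw [mul_comm, pow_mul, h2, ← Nat.div_add_mod k 4, pow_add, pow_mul, I_pow_four, one_pow,
        one_mul]
      have := Nat.mod_lt k (show 0 < 4 by norm_num)
      interval_cases k % 4 <;> simp
  · simp only [Set.mem_insert_iff, Set.mem_singleton_iff]
    norm_num
    constructor
    · rintro (h | h)
      exacts [⟨1, by rw [h, one_mul, h4]⟩, ⟨0, by rw [h, zero_mul, pow_zero]⟩]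
    · rintro ⟨k, rfl⟩
      rw [mul_comm, pow_mul, h4]
      exact (neg_one_pow_eq_or ℂ k).symm
  · obtain ⟨m, rfl⟩ := Nat.exists_eq_add_of_le hn
    have hω (k : ℕ) : omega ^ (k * 2 ^ (4 + m - 1)) = 1 := by
      rw [show 4 + m - 1 = 3 + m by omega,
        show k * 2 ^ (3 + m) = 8 * (k * 2 ^ m) by rw [pow_add]; ring, pow_mul, omega_pow_eight,
        one_pow]
    refine ⟨fun h => ⟨0, by rw [h.1 hn, hω]⟩, ?_⟩
    rintro ⟨k, rfl⟩
    rw [hω]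
    exact ⟨fun _ => rfl, fun h => by omega, fun h => by omega, fun h => by omega⟩

end CliffordT

theorem mainTheorem2 (n : ℕ)
    (U : Matrix (CliffordT.Basis n) (CliffordT.Basis n) ℂ)
    (hU : U ∈ Matrix.unitaryGroup (CliffordT.Basis n) ℂ) :
    (∃ C : CliffordT.Circuit n, CliffordT.Circuit.toMatrix C = U) ↔
      ((∀ x y, U x y ∈ CliffordT.ringZ) ∧
        (4 ≤ n → U.det = 1) ∧
        (n = 3 → U.det ∈ ({-1, 1} : Set ℂ)) ∧
        (n = 2 → U.det ∈ ({Complex.I, -1, -Complex.I, 1} : Set ℂ)) ∧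
        (n ≤ 1 → U.det ∈ ({CliffordT.omega, Complex.I, CliffordT.omega ^ 3, -1,
          CliffordT.omega ^ 5, -Complex.I, CliffordT.omega ^ 7, 1} : Set ℂ))) := by
  rw [← CliffordT.mem_cliffordT_iff, CliffordT.det_condition_iff]
  constructor
  · exact fun h => ⟨CliffordT.cliffordT_apply_mem_ringZ h, CliffordT.det_cliffordT h⟩
  · rintro ⟨hR, k, hk⟩
    obtain ⟨D, hD, hdet⟩ := CliffordT.exists_mem_cliffordT_det_eq n k
    exact CliffordT.unitary_mem_cliffordT (Matrix.mem_unitaryGroup_iff'.1 hU) hR hD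
      (hdet.trans hk.symm)
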